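/- Let $J$ be the counterclockwise rotation of $\mathbb{R}^2$ by $\pi/2$, let $H^1_{per}=H^1_{per}([0,2\pi];\mathbb{R}^2)$ be the space of $\eta\in H^1([0,2\pi];\mathbb{R}^2)$ with $\eta(0)=\eta(2\pi)$, and let $H^2_{imm}$ be the set of regular closed curves $\gamma\in H^2([0,2\pi];\mathbb{R}^2)$, that is, $\partial_x\gamma\neq 0$ on $[0,2\pi]$, $\gamma(0)=\gamma(2\pi)$ and $\partial_x\gamma(0)=\partial_x\gamma(2\pi)$; functions are identified with their continuous representatives and extended $2\pi$-periodically to $\mathbb{R}$. For $\gamma\in H^2_{imm}$ and $\eta\in H^1_{per}$ write $\partial_s=|\partial_x\gamma|^{-1}\partial_x$, $\mathrm{d}s=|\partial_x\gamma|\,\mathrm{d}x$, $\tau=\partial_s\gamma$, $\nu=J\tau$, $\partial_s\tau=\kappa\nu$, $\operatorname{div}_\gamma\eta=\langle\partial_s\eta,\tau\rangle$, $\nabla_\gamma\eta=\partial_s\eta\otimes\tau$, and $$L(\gamma)=\int_0^{2\pi}|\partial_x\gamma|\,\mathrm{d}x,\qquad A(\gamma)=-\frac12\int_0^{2\pi}\langle\gamma,J\partial_x\gamma\rangle\,\mathrm{d}x,$$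 $$E_{LM}(\gamma,\eta)=\frac12\int_\gamma(\kappa+\delta\operatorname{div}_\gamma\eta)^2\,\mathrm{d}s+\frac{\lambda}{2}\int_\gamma|\nabla_\gamma\eta|^2\,\mathrm{d}s+L(\gamma).$$ Fix $\delta,\lambda,A_0\in\mathbb{R}$ with $\lambda>0$ and let $$\mathcal{A}=\{(\gamma,\eta)\in H^2_{imm}\times H^1_{per}\colon A(\gamma)=A_0,\ |\eta|=1\text{ pointwise}\}.$$ (i) The class $\mathcal{A}$ is nonempty. If $A_0\neq0$, it contains $(\gamma,\nu)$ for the circle $\gamma(x)=\sqrt{|A_0|/\pi}\,(\cos x,\operatorname{sign}(A_0)\sin x)$ and its unit normal $\nu$; if $A_0=0$, it contains $(\gamma,\nu)$ for the figure eight $\gamma(x)=(\sin x,\sin 2x)$ and its unit normal $\nu$. (ii) The constraints pass to the limit: if $(\gamma_k,\eta_k)\in\mathcal{A}$ for all $k\in\mathbb{N}$, $(\gamma,\eta)\in H^2_{imm}\times H^1_{per}$, $\gamma_k\to\gamma$ strongly in $H^1$ and $\eta_k\to\eta$ strongly in $L^2$, then $(\gamma,\eta)\in\mathcal{A}$. (iii)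 $E_{LM}$ attains its minimum on $\mathcal{A}$: there is $(\gamma,\eta)\in\mathcal{A}$ with $E_{LM}(\gamma,\eta)\le E_{LM}(\tilde\gamma,\tilde\eta)$ for all $(\tilde\gamma,\tilde\eta)\in\mathcal{A}$. Moreover, the minimizer can be chosen such that $|\partial_x\gamma|=L(\gamma)/(2\pi)$ on $[0,2\pi]$ and $\int_0^{2\pi}\gamma\,\mathrm{d}x=0$. -/

import Mathlib

open scoped RealInnerProductSpace Topology
open Filter MeasureTheory

noncomputable section

namespace Surfactant

/-- The Euclidean plane. -/
abbrev Plane : Type := EuclideanSpace ℝ (Fin 2)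

/-- `f ∈ H¹_per([0,2π]; ℝ²)`. Functions on `[0,2π]` whose values at the two end points agree are
extended to `ℝ` by periodicity. In one dimension a function is of class `H¹` exactly if its
continuous representative, which is the one considered here, is absolutely continuous with square
integrable derivative; the weak derivative is then the derivative `deriv f`, which exists almost
everywhere. -/
structure MemH1per (f : ℝ → Plane) : Prop where
  periodic : Function.Periodic f (2 * Real.pi)
  absCont : AbsolutelyContinuousOnInterval f 0 (2 * Real.pi)
  deriv_memLp : MemLp (deriv f) 2 (volume.restrict (Set.Icc 0 (2 * Real.pi)))

/-- `f ∈ H²_per([0,2π]; ℝ²)`: the periodic extension is differentiable (so that both `f` and its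
first derivative match at the end points) and its derivative is of class `H¹_per`. -/
structure MemH2per (f : ℝ → Plane) : Prop where
  periodic : Function.Periodic f (2 * Real.pi)
  differentiable : Differentiable ℝ f
  deriv_mem : MemH1per (deriv f)

/-- `γ ∈ H²_imm([0,2π]; ℝ²)`: closed regular plane curves of class `H²`. -/
structure MemH2imm (γ : ℝ → Plane) : Prop where
  mem_H2per : MemH2per γ
  regular : ∀ x, deriv γ x ≠ 0

/-- The counterclockwise rotation `J` of the plane by `π/2`. -/
def rot (v : Plane) : Plane := !₂[-(v 1), v 0]

/-- The arc length derivative `∂_s f = |∂ₓγ|⁻¹ ∂ₓ f` along the curve `γ`. -/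
def arcDeriv (γ f : ℝ → Plane) (x : ℝ) : Plane := ‖deriv γ x‖⁻¹ • deriv f x

/-- The unit tangent `τ = ∂_s γ`. -/
def tangent (γ : ℝ → Plane) : ℝ → Plane := arcDeriv γ γ

/-- The unit normal `ν = Jτ`. -/
def normal (γ : ℝ → Plane) (x : ℝ) : Plane := rot (tangent γ x)

/-- The oriented curvature `κ = ⟨∂_s τ, ν⟩`; since `∂_s τ` is a multiple of the unit vector `ν`,
this is the scalar with `∂_s τ = κ ν`. -/
def curvature (γ : ℝ → Plane) (x : ℝ) : ℝ := ⟪arcDeriv γ (tangent γ) x, normal γ x⟫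

/-- The divergence `div_γ η = ⟨∂_s η, τ⟩`. -/
def curveDiv (γ η : ℝ → Plane) (x : ℝ) : ℝ := ⟪arcDeriv γ η x, tangent γ x⟫

/-- The gradient `∇_γ η = ∂_s η ⊗ τ`, whose rows are the gradients of the components of `η`. -/
def curveGrad (γ η : ℝ → Plane) (x : ℝ) : Matrix (Fin 2) (Fin 2) ℝ :=
  Matrix.of fun i j => arcDeriv γ η x i * tangent γ x j

/-- The square `|M|²` of the Euclidean (Frobenius) norm of a matrix. -/
def frobeniusSq (M : Matrix (Fin 2) (Fin 2) ℝ) : ℝ := ∑ i, ∑ j, M i j ^ 2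

/-- The integral `∫_γ f ds = ∫₀^{2π} f |∂ₓγ| dx`. -/
def curveIntegral (γ : ℝ → Plane) (f : ℝ → ℝ) : ℝ :=
  ∫ x in (0 : ℝ)..(2 * Real.pi), f x * ‖deriv γ x‖

/-- The length `L(γ)`. -/
def length (γ : ℝ → Plane) : ℝ := ∫ x in (0 : ℝ)..(2 * Real.pi), ‖deriv γ x‖

/-- The enclosed signed area `A(γ) = -½ ∫₀^{2π} ⟨γ, J ∂ₓγ⟩ dx`. -/
def signedArea (γ : ℝ → Plane) : ℝ :=
  -(1 / 2) * ∫ x in (0 : ℝ)..(2 * Real.pi), ⟪γ x, rot (deriv γ x)⟫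

/-- The energy `E_LM(γ, η) = ½ ∫_γ (κ + δ div_γ η)² ds + (λ/2) ∫_γ |∇_γ η|² ds + L(γ)`. -/
def energyLM (δ lam : ℝ) (p : (ℝ → Plane) × (ℝ → Plane)) : ℝ :=
  1 / 2 * curveIntegral p.1 (fun x => (curvature p.1 x + δ * curveDiv p.1 p.2 x) ^ 2)
    + lam / 2 * curveIntegral p.1 (fun x => frobeniusSq (curveGrad p.1 p.2 x))
    + length p.1

/-- The admissible class: pairs `(γ, η) ∈ H²_imm × H¹_per` with `A(γ) = A₀` and `|η| = 1`. -/
def admissible (A₀ : ℝ) : Set ((ℝ → Plane) × (ℝ → Plane)) :=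
  {p | MemH2imm p.1 ∧ MemH1per p.2 ∧ signedArea p.1 = A₀ ∧ ∀ x, ‖p.2 x‖ = 1}

/-- The circle about the origin that encloses the signed area `A₀ ≠ 0`, parametrized
counterclockwise if `A₀ > 0` and clockwise if `A₀ < 0`. -/
def circleOfArea (A₀ : ℝ) (x : ℝ) : Plane :=
  !₂[√(|A₀| / Real.pi) * Real.cos x, Real.sign A₀ * √(|A₀| / Real.pi) * Real.sin x]

/-- The figure eight `x ↦ (sin x, sin 2x)`. -/
def figureEight (x : ℝ) : Plane := !₂[Real.sin x, Real.sin (2 * x)]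

end Surfactant

end

/-! The proof is the direct method. Energy, area and constraint `|η| = 1` are invariant under
reparametrization and translation (`IsReparam.energyLM_comp`, `exists_constSpeed`), so a minimizing
sequence may be taken with constant speed `l` and `γ 0 = 0`.

Coercivity (`coercive`) holds for every `δ`: the last two energy terms bound `l` and `∫ |η'|²`, and
since `|div_γ η| ≤ |∇_γ η|`, the coupling can be subtracted from `κ + δ div_γ η` to bound `∫ |γ''|²`
by a multiple of `l³`. As `γ'` has mean zero and norm `l`, a Poincaré argument gives `l² ≤ 2π ∫
|γ''|²`; the cubic power then keeps `l` away from zero, so curves cannot shrink to a point.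

Hence, along a subsequence, `γ'` and `η` converge pointwise and their derivatives weakly in `L²`
(`exists_H1_limit`). Area and `|η| = 1` survive strong convergence (`mem_admissible_of_tendsto`). At
constant speed the bending density is linear in `(γ'', η')`, with coefficients that converge
boundedly, so it converges weakly when tested against `L²` functions; the inequality `∫ f² ≥ 2 ∫ f W
- ∫ W²` with `W` the limit density yields lower semicontinuity (`energyLM_le_of_tendsto`). The
circle and the figure eight show that there are competitors. -/

noncomputable section

namespace Surfactant

/-! ### Absolutely continuous functions with values in the plane -/

section AbsolutelyContinuous

/-- The sums of increments of `h` are squeezed between zero and `C` times those of `g`. Regularity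
is transferred through this comparison throughout. -/
theorem ac_of_dist_le {X Y : Type*} [PseudoMetricSpace X] [PseudoMetricSpace Y]
    {g : ℝ → X} {h : ℝ → Y} {a b C : ℝ} (hg : AbsolutelyContinuousOnInterval g a b)
    (hle : ∀ x ∈ Set.uIcc a b, ∀ y ∈ Set.uIcc a b, dist (h x) (h y) ≤ C * dist (g x) (g y)) :
    AbsolutelyContinuousOnInterval h a b := by
  refine squeeze_zero' (Eventually.of_forall fun E => Finset.sum_nonneg fun i _ => dist_nonneg) ?_
    (by simpa using Filter.Tendsto.const_mul C (id hg : Tendsto _ _ _))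
  rw [eventually_inf_principal]
  refine Eventually.of_forall fun E hE => ?_
  rw [Finset.mul_sum]
  exact Finset.sum_le_sum fun i hi => hle _ (hE.1 i hi).1 _ (hE.1 i hi).2

theorem ac_ae_differentiableAt {f : ℝ → Plane} {a b : ℝ}
    (hf : AbsolutelyContinuousOnInterval f a b) :
    ∀ᵐ x : ℝ, x ∈ Set.uIcc a b → DifferentiableAt ℝ f x :=
  hf.boundedVariationOn.ae_differentiableAt_of_mem_uIcc

/-- Increments are dominated by those of the real primitive of `‖U‖`, which reduces the claim to the
scalar case. -/
theorem ac_primitive {E : Type*} [NormedAddCommGroup E] [NormedSpace ℝ E] {U : ℝ → E} {a b : ℝ}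
    (hU : IntervalIntegrable U volume a b) :
    AbsolutelyContinuousOnInterval (fun x => ∫ t in a..x, U t) a b := by
  refine ac_of_dist_le (C := 1)
    (hU.norm.absolutelyContinuousOnInterval_intervalIntegral (c := a) Set.left_mem_uIcc) ?_
  intro x hx y hy
  have key : ∀ z ∈ Set.uIcc a b, IntervalIntegrable U volume a z := fun z hz =>
    hU.mono_set (Set.uIcc_subset_uIcc Set.left_mem_uIcc hz)
  rw [one_mul, dist_eq_norm, Real.dist_eq,
    intervalIntegral.integral_interval_sub_left (key x hx) (key y hy),
    intervalIntegral.integral_interval_sub_left (key x hx).norm (key y hy).norm]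
  exact intervalIntegral.norm_integral_le_abs_integral_norm

/-- The difference of `f` and the primitive is absolutely continuous with derivative zero almost
everywhere, hence constant. -/
theorem ac_integral_deriv_eq_sub {f : ℝ → Plane} {a b : ℝ}
    (hf : AbsolutelyContinuousOnInterval f a b)
    (hi : IntervalIntegrable (deriv f) volume a b) {x : ℝ} (hx : x ∈ Set.uIcc a b) :
    ∫ t in a..x, deriv f t = f x - f a := by
  have hac := hf.sub (ac_primitive hi)
  have hd : ∀ᵐ x, x ∈ Set.uIcc a b →
      HasDerivAt (f - fun x => ∫ t in a..x, deriv f t) 0 x := by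
    filter_upwards [ac_ae_differentiableAt hf, hi.ae_hasDerivAt_integral] with x hx₁ hx₂ hx₃
    simpa using! (hx₁ hx₃).hasDerivAt.sub (hx₂ hx₃ a Set.left_mem_uIcc)
  obtain ⟨C, hC⟩ := hac.const_of_ae_hasDerivAt_zero hd
  have h1 := hC x hx
  have h2 := hC a Set.left_mem_uIcc
  simp only [Pi.sub_apply, intervalIntegral.integral_same, sub_zero] at h1 h2
  rw [h2, ← h1]
  abel

end AbsolutelyContinuous

/-! ### Periodic functions of class `H¹` -/

/-- Lebesgue measure on the period `(0, 2π]`. -/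
abbrev periodMeasure : Measure ℝ := volume.restrict (Set.Ioc 0 (2 * Real.pi))

theorem two_pi_nonneg : (0 : ℝ) ≤ 2 * Real.pi := Real.two_pi_pos.le

theorem restrict_Icc_period :
    volume.restrict (Set.Icc 0 (2 * Real.pi)) = periodMeasure :=
  (Measure.restrict_congr_set Ioc_ae_eq_Icc).symm

theorem periodIntegral {E : Type*} [NormedAddCommGroup E] [NormedSpace ℝ E] (f : ℝ → E) :
    ∫ x in (0 : ℝ)..(2 * Real.pi), f x = ∫ x, f x ∂periodMeasure :=
  intervalIntegral.integral_of_le two_pi_nonneg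

theorem intervalIntegrable_period {E : Type*} [NormedAddCommGroup E] {f : ℝ → E} :
    IntervalIntegrable f volume 0 (2 * Real.pi) ↔ Integrable f periodMeasure :=
  intervalIntegrable_iff_integrableOn_Ioc_of_le two_pi_nonneg

theorem memLp_two_period_intervalIntegrable {f : ℝ → Plane} (hf : MemLp f 2 periodMeasure) :
    IntervalIntegrable f volume 0 (2 * Real.pi) :=
  intervalIntegrable_period.2 (hf.integrable one_le_two)

theorem MemH1per.memLp {f : ℝ → Plane} (hf : MemH1per f) : MemLp (deriv f) 2 periodMeasure :=
  restrict_Icc_period ▸ hf.deriv_memLp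

theorem ae_period_of_ae {p : ℝ → Prop}
    (h : ∀ᵐ x : ℝ, x ∈ Set.uIcc 0 (2 * Real.pi) → p x) : ∀ᵐ x ∂periodMeasure, p x := by
  rw [ae_restrict_iff' measurableSet_Ioc]
  filter_upwards [h] with x hx h'
  exact hx (by rw [Set.uIcc_of_le two_pi_nonneg]; exact Set.Ioc_subset_Icc_self h')

theorem MemH1per.ae_differentiableAt {f : ℝ → Plane} (hf : MemH1per f) :
    ∀ᵐ x ∂periodMeasure, DifferentiableAt ℝ f x :=
  ae_period_of_ae (ac_ae_differentiableAt hf.absCont)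

theorem MemH1per.eq_add_integral {f : ℝ → Plane} (hf : MemH1per f) {x : ℝ}
    (hx : x ∈ Set.Icc 0 (2 * Real.pi)) : f x = f 0 + ∫ t in (0 : ℝ)..x, deriv f t := by
  rw [ac_integral_deriv_eq_sub hf.absCont (memLp_two_period_intervalIntegrable hf.memLp)
    (by rwa [Set.uIcc_of_le two_pi_nonneg])]
  abel

/-- Matching end values let `f` descend to a continuous function on the circle, from which it is
pulled back. -/
theorem continuous_of_periodic {E : Type*} [TopologicalSpace E] {f : ℝ → E} {T : ℝ} (hT : 0 < T)
    (hp : Function.Periodic f T) (hc : ContinuousOn f (Set.Icc 0 T)) : Continuous f := by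
  have : Fact (0 < T) := ⟨hT⟩
  have h := AddCircle.liftIco_continuous (p := T) (a := 0) (f := f)
    (by simpa using (hp 0).symm) (by simpa using hc)
  have h2 : f = (AddCircle.liftIco T 0 f) ∘ ((↑) : ℝ → AddCircle T) := by
    funext x
    have hx := toIcoMod_mem_Ico hT 0 x
    have e1 : ((x : ℝ) : AddCircle T) = ((toIcoMod hT 0 x : ℝ) : AddCircle T) := by
      rw [← self_sub_toIcoDiv_zsmul, AddCircle.coe_sub, AddCircle.coe_zsmul, AddCircle.coe_period]
      simp
    rw [Function.comp_apply, e1, AddCircle.liftIco_coe_apply hx]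
    rw [← self_sub_toIcoDiv_zsmul, hp.sub_zsmul_eq]
  rw [h2]
  exact h.comp (AddCircle.continuous_mk' T)

theorem MemH1per.continuous {f : ℝ → Plane} (hf : MemH1per f) : Continuous f :=
  continuous_of_periodic Real.two_pi_pos hf.periodic
    (by simpa [Set.uIcc_of_le two_pi_nonneg] using hf.absCont.continuousOn)

theorem exists_mem_period {E : Type*} {f : ℝ → E} (hp : Function.Periodic f (2 * Real.pi))
    (x : ℝ) : ∃ y ∈ Set.Ico 0 (2 * Real.pi), f x = f y :=
  hp.exists_mem_Ico₀ Real.two_pi_pos x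

theorem bounded_of_periodic {E : Type*} [NormedAddCommGroup E] {f : ℝ → E}
    (hp : Function.Periodic f (2 * Real.pi)) (hc : Continuous f) : ∃ C, ∀ x, ‖f x‖ ≤ C := by
  obtain ⟨C, hC⟩ := isCompact_Icc.exists_bound_of_continuousOn
    (hc.continuousOn (s := Set.Icc 0 (2 * Real.pi)))
  refine ⟨C, fun x => ?_⟩
  obtain ⟨y, hy, h⟩ := exists_mem_period hp x
  exact h ▸ hC y (Set.Ico_subset_Icc_self hy)

theorem norm_deriv_le_of_dist_le {g h : ℝ → Plane} {C x : ℝ} (hC : 0 ≤ C)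
    (hle : ∀ x y, dist (h x) (h y) ≤ C * dist (g x) (g y)) (hg : DifferentiableAt ℝ g x) :
    ‖deriv h x‖ ≤ C * ‖deriv g x‖ := by
  by_cases hh : DifferentiableAt ℝ h x
  · have h1 := (hasDerivAt_iff_tendsto_slope.1 hh.hasDerivAt).norm
    have h2 := ((hasDerivAt_iff_tendsto_slope.1 hg.hasDerivAt).norm).const_mul C
    refine le_of_tendsto_of_tendsto h1 h2 (Eventually.of_forall fun y => ?_)
    simp only [slope, vsub_eq_sub, norm_smul]
    have := hle y x
    rw [dist_eq_norm, dist_eq_norm] at this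
    calc ‖(y - x)⁻¹‖ * ‖h y - h x‖ ≤ ‖(y - x)⁻¹‖ * (C * ‖g y - g x‖) := by gcongr
      _ = _ := by ring
  -- Where `h` is not differentiable, `deriv h` is zero by convention and the bound is trivial; only
  -- `g` needs a derivative.
  · rw [deriv_zero_of_not_differentiableAt hh, norm_zero]
    positivity

/-- A function whose increments are controlled by those of a function of class `H¹_per` is of
class `H¹_per`. -/
theorem MemH1per.of_dist_le {g h : ℝ → Plane} {C : ℝ} (hg : MemH1per g)
    (hle : ∀ x y, dist (h x) (h y) ≤ C * dist (g x) (g y)) : MemH1per h := by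
  have hle' : ∀ x y, dist (h x) (h y) ≤ |C| * dist (g x) (g y) := fun x y =>
    (hle x y).trans (mul_le_mul_of_nonneg_right (le_abs_self C) dist_nonneg)
  refine ⟨fun x => ?_, ac_of_dist_le hg.absCont fun x _ y _ => hle x y, ?_⟩
  · have := hle (x + 2 * Real.pi) x
    rw [hg.periodic x, dist_self, mul_zero] at this
    exact dist_le_zero.1 this
  · rw [restrict_Icc_period]
    refine hg.memLp.of_le_mul (c := |C|) (aestronglyMeasurable_deriv h _) ?_
    filter_upwards [hg.ae_differentiableAt] with x hx
    exact norm_deriv_le_of_dist_le (abs_nonneg C) hle' hx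

theorem MemH1per.const_smul {f : ℝ → Plane} (hf : MemH1per f) (c : ℝ) :
    MemH1per (fun x => c • f x) :=
  hf.of_dist_le (C := |c|) fun x y => by rw [dist_smul₀, Real.norm_eq_abs]

theorem MemH1per.congr_deriv_ae {f U : ℝ → Plane} (hU : MemLp U 2 periodMeasure)
    (h : ∀ x ∈ Set.Icc 0 (2 * Real.pi), f x = f 0 + ∫ t in (0 : ℝ)..x, U t) :
    deriv f =ᵐ[periodMeasure] U := by
  have hi := memLp_two_period_intervalIntegrable hU
  have h1 := ae_period_of_ae hi.ae_hasDerivAt_integral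
  -- The formula for `f` is known only on the closed period, so the end point is discarded to have
  -- it on a neighbourhood.
  have h2 : ∀ᵐ x ∂periodMeasure, x ∈ Set.Ioo 0 (2 * Real.pi) := by
    rw [periodMeasure, ← restrict_Ioo_eq_restrict_Ioc]
    exact ae_restrict_mem measurableSet_Ioo
  filter_upwards [h1, h2] with x hx hx2
  have hd := (hx 0 Set.left_mem_uIcc).const_add (f 0)
  refine (hd.congr_of_eventuallyEq ?_).deriv
  filter_upwards [Ioo_mem_nhds hx2.1 hx2.2] with y hy
  exact h y (Set.Ioo_subset_Icc_self hy)

/-- A periodic function that is a primitive of an `L²` function on one period is of class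
`H¹_per`. -/
theorem MemH1per.of_primitive {f U : ℝ → Plane} (hp : Function.Periodic f (2 * Real.pi))
    (hU : MemLp U 2 periodMeasure)
    (h : ∀ x ∈ Set.Icc 0 (2 * Real.pi), f x = f 0 + ∫ t in (0 : ℝ)..x, U t) : MemH1per f := by
  refine ⟨hp, ?_, ?_⟩
  · refine ac_of_dist_le (C := 1) (ac_primitive (memLp_two_period_intervalIntegrable hU)) ?_
    intro x hx y hy
    rw [Set.uIcc_of_le two_pi_nonneg] at hx hy
    rw [h x hx, h y hy, one_mul, dist_add_left]
  · rw [restrict_Icc_period]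
    exact (memLp_congr_ae (MemH1per.congr_deriv_ae hU h)).2 hU

theorem memLp_period_of_continuous {f : ℝ → Plane} (hf : Continuous f) :
    MemLp f 2 periodMeasure := by
  obtain ⟨C, hC⟩ := isCompact_Icc.exists_bound_of_continuousOn
    (hf.continuousOn (s := Set.Icc 0 (2 * Real.pi)))
  refine MemLp.of_bound hf.aestronglyMeasurable C ?_
  filter_upwards [ae_restrict_mem measurableSet_Ioc] with x hx
  exact hC x (Set.Ioc_subset_Icc_self hx)

theorem MemH1per.of_contDiff {f : ℝ → Plane} (hp : Function.Periodic f (2 * Real.pi))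
    (hf : ContDiff ℝ 1 f) : MemH1per f :=
  ⟨hp, hf.contDiffOn.absolutelyContinuousOnInterval, restrict_Icc_period ▸
    memLp_period_of_continuous (hf.continuous_deriv le_rfl)⟩

/-! ### Invariance under reparametrization -/

/-- An orientation preserving `C¹` reparametrization of `ℝ / 2πℤ` that fixes `0`, with its inverse
and its derivative. -/
structure IsReparam (φ σ φ' : ℝ → ℝ) : Prop where
  hasDerivAt : ∀ y, HasDerivAt φ (φ' y) y
  pos : ∀ y, 0 < φ' y
  continuous_deriv : Continuous φ'
  left_inv : ∀ y, σ (φ y) = y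
  right_inv : ∀ x, φ (σ x) = x
  differentiable_inv : Differentiable ℝ σ
  add_period : ∀ y, φ (y + 2 * Real.pi) = φ y + 2 * Real.pi
  map_zero : φ 0 = 0

namespace IsReparam

variable {φ σ φ' : ℝ → ℝ}

theorem strictMono (h : IsReparam φ σ φ') : StrictMono φ :=
  strictMono_of_deriv_pos fun y => by rw [(h.hasDerivAt y).deriv]; exact h.pos y

theorem map_period (h : IsReparam φ σ φ') : φ (2 * Real.pi) = 2 * Real.pi := by
  have := h.add_period 0
  rwa [zero_add, h.map_zero, zero_add] at this

/-- The chain rule holds at every point, because `f` is differentiable at `φ y` as soon as `f ∘ φ`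
is differentiable at `y`. -/
theorem deriv_comp (h : IsReparam φ σ φ') (f : ℝ → Plane) (y : ℝ) :
    deriv (fun y => f (φ y)) y = φ' y • deriv f (φ y) := by
  by_cases hf : DifferentiableAt ℝ f (φ y)
  · exact (hf.hasDerivAt.scomp y (h.hasDerivAt y)).deriv
  · rw [deriv_zero_of_not_differentiableAt hf, smul_zero]
    refine deriv_zero_of_not_differentiableAt fun hc => hf ?_
    have h1 : DifferentiableAt ℝ (fun y => f (φ y)) (σ (φ y)) := by rwa [h.left_inv]
    have h2 := h1.comp (φ y) (h.differentiable_inv (φ y))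
    refine h2.congr_of_eventuallyEq (Eventually.of_forall fun x => ?_)
    simp [h.right_inv]

/-- The factor `φ' > 0` cancels between the derivative of `f` and the speed of `γ`; every geometric
quantity in the energy inherits this. -/
theorem arcDeriv_comp (h : IsReparam φ σ φ') (γ f : ℝ → Plane) (y : ℝ) :
    arcDeriv (fun y => γ (φ y)) (fun y => f (φ y)) y = arcDeriv γ f (φ y) := by
  simp only [arcDeriv, h.deriv_comp, norm_smul, smul_smul, Real.norm_eq_abs, abs_of_pos (h.pos y)]
  congr 1
  have := (h.pos y).ne'
  rw [mul_inv, mul_right_comm, inv_mul_cancel₀ this, one_mul]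

theorem tangent_comp (h : IsReparam φ σ φ') (γ : ℝ → Plane) :
    tangent (fun y => γ (φ y)) = fun y => tangent γ (φ y) :=
  funext fun y => h.arcDeriv_comp γ γ y

theorem image_Icc (h : IsReparam φ σ φ') (x : ℝ) : φ '' Set.Icc 0 x = Set.Icc 0 (φ x) := by
  rw [← h.map_zero]
  ext z
  constructor
  · rintro ⟨y, hy, rfl⟩
    exact ⟨h.strictMono.monotone (by simpa [h.map_zero] using hy.1), h.strictMono.monotone hy.2⟩
  · intro hz
    refine ⟨σ z, ⟨?_, ?_⟩, h.right_inv z⟩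
    · rw [← h.strictMono.le_iff_le, h.right_inv]; simpa [h.map_zero] using hz.1
    · rw [← h.strictMono.le_iff_le, h.right_inv]; exact hz.2

theorem integrableOn_comp (h : IsReparam φ σ φ') {E : Type*} [NormedAddCommGroup E]
    [NormedSpace ℝ E] (f : ℝ → E) :
    Integrable (fun y => φ' y • f (φ y)) periodMeasure ↔ Integrable f periodMeasure := by
  have := integrableOn_image_iff_integrableOn_deriv_smul_of_monotoneOn
    (measurableSet_Icc (a := (0 : ℝ)) (b := 2 * Real.pi))
    (fun y _ => (h.hasDerivAt y).hasDerivWithinAt) (h.strictMono.monotone.monotoneOn _) f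
  rw [h.image_Icc, h.map_period, IntegrableOn, IntegrableOn, restrict_Icc_period] at this
  exact this.symm

theorem integral_comp (h : IsReparam φ σ φ') {E : Type*} [NormedAddCommGroup E]
    [NormedSpace ℝ E] (f : ℝ → E) {x : ℝ} (hx : 0 ≤ x) :
    ∫ y in (0 : ℝ)..x, φ' y • f (φ y) = ∫ t in (0 : ℝ)..φ x, f t := by
  have := integral_image_eq_integral_deriv_smul_of_monotoneOn
    (measurableSet_Icc (a := (0 : ℝ)) (b := x))
    (fun y _ => (h.hasDerivAt y).hasDerivWithinAt) (h.strictMono.monotone.monotoneOn _) f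
  have h0 : 0 ≤ φ x := h.map_zero ▸ h.strictMono.monotone hx
  rw [h.image_Icc, integral_Icc_eq_integral_Ioc, integral_Icc_eq_integral_Ioc] at this
  rw [intervalIntegral.integral_of_le hx, intervalIntegral.integral_of_le h0, this]

theorem periodic_comp (h : IsReparam φ σ φ') {E : Type*} {f : ℝ → E}
    (hf : Function.Periodic f (2 * Real.pi)) :
    Function.Periodic (fun y => f (φ y)) (2 * Real.pi) := fun y => by
  simp only [h.add_period]
  exact hf _

theorem memH1per_comp (h : IsReparam φ σ φ') {f : ℝ → Plane} (hf : MemH1per f) :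
    MemH1per (fun y => f (φ y)) := by
  have hint : Integrable (fun y => φ' y • ‖deriv f (φ y)‖ ^ 2) periodMeasure :=
    (h.integrableOn_comp fun x => ‖deriv f x‖ ^ 2).2
      ((memLp_two_iff_integrable_sq_norm (aestronglyMeasurable_deriv f _)).1 hf.memLp)
  obtain ⟨C, hC⟩ := isCompact_Icc.exists_bound_of_continuousOn
    (h.continuous_deriv.continuousOn (s := Set.Icc 0 (2 * Real.pi)))
  have hU : MemLp (deriv fun y => f (φ y)) 2 periodMeasure := by
    have hm := aestronglyMeasurable_deriv (fun y => f (φ y)) periodMeasure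
    rw [memLp_two_iff_integrable_sq_norm hm]
    -- Of the two factors `φ'` in the squared derivative, one is bounded by `C` and the other is
    -- absorbed by the change of variables.
    refine (hint.const_mul C).mono (hm.norm.pow 2) ?_
    filter_upwards [ae_restrict_mem measurableSet_Ioc] with y hy
    have h1 := hC y (Set.Ioc_subset_Icc_self hy)
    have h0 := h.pos y
    rw [Real.norm_eq_abs, abs_of_pos h0] at h1
    rw [h.deriv_comp, norm_smul, Real.norm_eq_abs, Real.norm_eq_abs, Real.norm_eq_abs,
      abs_of_pos h0, smul_eq_mul, abs_of_nonneg (by positivity),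
      abs_of_nonneg (by have := h0.le.trans h1; positivity)]
    calc (φ' y * ‖deriv f (φ y)‖) ^ 2 = φ' y * (φ' y * ‖deriv f (φ y)‖ ^ 2) := by ring
      _ ≤ C * (φ' y * ‖deriv f (φ y)‖ ^ 2) := by gcongr
  refine MemH1per.of_primitive (h.periodic_comp hf.periodic) hU fun x hx => ?_
  simp only [h.deriv_comp]
  rw [h.integral_comp _ hx.1, h.map_zero]
  refine hf.eq_add_integral ?_
  rw [← h.map_period, ← h.image_Icc]
  exact ⟨x, hx, rfl⟩

theorem curveIntegral_comp (h : IsReparam φ σ φ') (γ : ℝ → Plane) (f : ℝ → ℝ) :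
    curveIntegral (fun y => γ (φ y)) (fun y => f (φ y)) = curveIntegral γ f := by
  have := h.integral_comp (fun x => f x * ‖deriv γ x‖) two_pi_nonneg
  rw [h.map_period] at this
  rw [curveIntegral, curveIntegral, ← this]
  refine intervalIntegral.integral_congr fun y _ => ?_
  simp only [h.deriv_comp, norm_smul, Real.norm_eq_abs, abs_of_pos (h.pos y), smul_eq_mul]
  ring

theorem length_comp (h : IsReparam φ σ φ') (γ : ℝ → Plane) :
    length (fun y => γ (φ y)) = length γ := by
  simpa [curveIntegral, length] using h.curveIntegral_comp γ fun _ => 1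

theorem energyLM_comp (h : IsReparam φ σ φ') (δ lam : ℝ) (γ η : ℝ → Plane) :
    energyLM δ lam (fun y => γ (φ y), fun y => η (φ y)) = energyLM δ lam (γ, η) := by
  have h1 := h.curveIntegral_comp γ (fun x => (curvature γ x + δ * curveDiv γ η x) ^ 2)
  have h2 := h.curveIntegral_comp γ (fun x => frobeniusSq (curveGrad γ η x))
  simp only [energyLM, h.length_comp]
  rw [← h1, ← h2]
  simp only [curvature, curveDiv, curveGrad, normal, h.tangent_comp, h.arcDeriv_comp]

theorem signedArea_comp (h : IsReparam φ σ φ') (γ : ℝ → Plane) :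
    signedArea (fun y => γ (φ y)) = signedArea γ := by
  have := h.integral_comp (fun x => ⟪γ x, rot (deriv γ x)⟫) two_pi_nonneg
  rw [h.map_period] at this
  rw [signedArea, signedArea, ← this]
  congr 1
  refine intervalIntegral.integral_congr fun y _ => ?_
  simp only [h.deriv_comp, rot, PiLp.inner_apply, Fin.sum_univ_two]
  simp
  ring

end IsReparam

/-! ### Rotation, tangent and normal fields -/

theorem norm_rot (v : Plane) : ‖rot v‖ = ‖v‖ := by
  simp [EuclideanSpace.norm_eq, rot, Fin.sum_univ_two, add_comm]

theorem rot_sub (v w : Plane) : rot (v - w) = rot v - rot w := by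
  ext i; fin_cases i <;> simp [rot]; ring

theorem rot_smul (c : ℝ) (v : Plane) : rot (c • v) = c • rot v := by
  ext i; fin_cases i <;> simp [rot]

/-- Normalization is Lipschitz away from the origin, so the unit tangent inherits class `H¹` from
`γ'`. -/
theorem dist_normalize_le {m : ℝ} (hm : 0 < m) {a b : Plane} (ha : m ≤ ‖a‖) (hb : m ≤ ‖b‖) :
    dist (‖a‖⁻¹ • a) (‖b‖⁻¹ • b) ≤ 2 / m * dist a b := by
  have ha0 : 0 < ‖a‖ := hm.trans_le ha
  have hb0 : 0 < ‖b‖ := hm.trans_le hb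
  have h : ‖a‖⁻¹ • a - ‖b‖⁻¹ • b = ‖a‖⁻¹ • (a - b) + (‖a‖⁻¹ - ‖b‖⁻¹) • b := by
    rw [smul_sub, sub_smul]; abel
  have h2 : ‖(‖a‖⁻¹ - ‖b‖⁻¹) • b‖ = ‖a‖⁻¹ * |‖b‖ - ‖a‖| := by
    have : ‖a‖⁻¹ - ‖b‖⁻¹ = ‖a‖⁻¹ * ‖b‖⁻¹ * (‖b‖ - ‖a‖) := by field_simp
    rw [norm_smul, this, Real.norm_eq_abs, abs_mul, abs_of_pos (by positivity : 0 < ‖a‖⁻¹ * ‖b‖⁻¹)]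
    field_simp
  rw [dist_eq_norm, dist_eq_norm, h]
  calc _ ≤ ‖a‖⁻¹ * ‖a - b‖ + ‖a‖⁻¹ * ‖a - b‖ := by
        refine (norm_add_le _ _).trans (add_le_add (by rw [norm_smul]; simp) ?_)
        rw [h2, abs_sub_comm]
        gcongr
        exact abs_norm_sub_norm_le a b
    _ = 2 * ‖a‖⁻¹ * ‖a - b‖ := by ring
    _ ≤ _ := by
        rw [div_eq_mul_inv]
        gcongr

namespace MemH2imm

variable {γ : ℝ → Plane}

theorem differentiable (hγ : MemH2imm γ) : Differentiable ℝ γ := hγ.mem_H2per.differentiable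

theorem memH1per_deriv (hγ : MemH2imm γ) : MemH1per (deriv γ) := hγ.mem_H2per.deriv_mem

theorem continuous_deriv (hγ : MemH2imm γ) : Continuous (deriv γ) := hγ.memH1per_deriv.continuous

theorem norm_deriv_pos (hγ : MemH2imm γ) (x : ℝ) : 0 < ‖deriv γ x‖ :=
  norm_pos_iff.2 (hγ.regular x)

theorem exists_le_norm_deriv (hγ : MemH2imm γ) : ∃ m > 0, ∀ x, m ≤ ‖deriv γ x‖ := by
  obtain ⟨y, -, hy⟩ := (isCompact_Icc (a := (0 : ℝ)) (b := 2 * Real.pi)).exists_isMinOn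
    ⟨0, Set.left_mem_Icc.2 two_pi_nonneg⟩ hγ.continuous_deriv.norm.continuousOn
  refine ⟨‖deriv γ y‖, hγ.norm_deriv_pos y, fun x => ?_⟩
  obtain ⟨z, hz, h⟩ := exists_mem_period hγ.memH1per_deriv.periodic x
  exact h ▸ hy (Set.Ico_subset_Icc_self hz)

theorem memH1per_tangent (hγ : MemH2imm γ) : MemH1per (tangent γ) := by
  obtain ⟨m, hm, h⟩ := hγ.exists_le_norm_deriv
  exact hγ.memH1per_deriv.of_dist_le fun x y => dist_normalize_le hm (h x) (h y)

theorem norm_tangent (hγ : MemH2imm γ) (x : ℝ) : ‖tangent γ x‖ = 1 := by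
  rw [tangent, arcDeriv, norm_smul, norm_inv, norm_norm, inv_mul_cancel₀ (hγ.norm_deriv_pos x).ne']

theorem memH1per_normal (hγ : MemH2imm γ) : MemH1per (normal γ) :=
  hγ.memH1per_tangent.of_dist_le (C := 1) fun x y => by
    rw [one_mul, dist_eq_norm, dist_eq_norm, normal, normal, ← rot_sub, norm_rot]

theorem norm_normal (hγ : MemH2imm γ) (x : ℝ) : ‖normal γ x‖ = 1 := by
  rw [normal, norm_rot, hγ.norm_tangent]

theorem length_pos (hγ : MemH2imm γ) : 0 < length γ :=
  intervalIntegral.intervalIntegral_pos_of_pos_on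
    (hγ.continuous_deriv.norm.intervalIntegrable _ _) (fun x _ => hγ.norm_deriv_pos x)
    Real.two_pi_pos

end MemH2imm

/-! ### Arc length reparametrization -/

/-- Every regular closed curve has an arc length reparametrization. -/
theorem MemH2imm.exists_isReparam {γ : ℝ → Plane} (hγ : MemH2imm γ) :
    ∃ φ σ φ' : ℝ → ℝ, IsReparam φ σ φ' ∧
      ∀ y, φ' y * ‖deriv γ (φ y)‖ = length γ / (2 * Real.pi) := by
  set l := length γ / (2 * Real.pi) with hl
  have hl0 : 0 < l := div_pos hγ.length_pos Real.two_pi_pos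
  have hc : Continuous fun x => ‖deriv γ x‖ := hγ.continuous_deriv.norm
  -- Arc length, rescaled so that a full turn has parameter length `2π`; the reparametrization is
  -- its inverse.
  set σ : ℝ → ℝ := fun x => l⁻¹ * ∫ t in (0 : ℝ)..x, ‖deriv γ t‖ with hσ
  have hσd : ∀ x, HasDerivAt σ (l⁻¹ * ‖deriv γ x‖) x := fun x =>
    (hc.integral_hasStrictDerivAt 0 x).hasDerivAt.const_mul _
  have hσpos : ∀ x, 0 < l⁻¹ * ‖deriv γ x‖ := fun x =>
    mul_pos (inv_pos.2 hl0) (hγ.norm_deriv_pos x)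
  have hσ0 : σ 0 = 0 := by simp [hσ]
  have hσT : ∀ x, σ (x + 2 * Real.pi) = σ x + 2 * Real.pi := fun x => by
    have hp : Function.Periodic (fun x => ‖deriv γ x‖) (2 * Real.pi) := fun x => by
      simp only [hγ.memH1per_deriv.periodic x]
    have h1 := hp.intervalIntegral_add_eq x 0
    rw [zero_add] at h1
    have h2 := intervalIntegral.integral_add_adjacent_intervals
      (hc.intervalIntegrable 0 x) (hc.intervalIntegrable (μ := volume) x (x + 2 * Real.pi))
    simp only [hσ]
    rw [← h2, h1, mul_add]
    congr 1
    change l⁻¹ * length γ = _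
    rw [hl]
    field_simp [hγ.length_pos.ne']
  have hσm : StrictMono σ := strictMono_of_deriv_pos fun x => by rw [(hσd x).deriv]; exact hσpos x
  have hσc : Continuous σ := continuous_iff_continuousAt.2 fun x => (hσd x).continuousAt
  -- `σ x - x` is periodic and vanishes at zero, so `σ` fixes all multiples of `2π`; these bracket
  -- any value, which gives surjectivity by continuity.
  have hσn : ∀ n : ℤ, σ (n * (2 * Real.pi)) = n * (2 * Real.pi) := fun n => by
    have hp : Function.Periodic (fun x => σ x - x) (2 * Real.pi) := fun x => by
      simp only [hσT]; ring
    have := hp.int_mul_eq n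
    simp only [hσ0, sub_zero] at this
    linarith
  have hσs : Function.Surjective σ := fun y => by
    have h1 := Int.floor_le (y / (2 * Real.pi))
    have h2 := (Int.lt_floor_add_one (y / (2 * Real.pi))).le
    rw [le_div_iff₀ Real.two_pi_pos, ← hσn] at h1
    rw [div_le_iff₀ Real.two_pi_pos] at h2
    have h3 := hσn (⌊y / (2 * Real.pi)⌋ + 1)
    push_cast at h3
    rw [← h3] at h2
    exact mem_range_of_exists_le_of_exists_ge hσc ⟨_, h1⟩ ⟨_, h2⟩
  set e := hσm.orderIsoOfSurjective σ hσs with he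
  have her : ∀ x, e.symm (σ x) = x := fun x => e.symm_apply_apply x
  have hel : ∀ y, σ (e.symm y) = y := fun y => e.apply_symm_apply y
  refine ⟨e.symm, σ, fun y => (l⁻¹ * ‖deriv γ (e.symm y)‖)⁻¹, ?_, fun y => ?_⟩
  · have hec : Continuous e.symm := e.symm.continuous
    refine ⟨fun y => ?_, fun y => inv_pos.2 (hσpos _), ?_, hel, her,
      fun x => (hσd x).differentiableAt, fun y => ?_, ?_⟩
    · exact HasDerivAt.of_local_left_inverse hec.continuousAt (hσd _) (hσpos _).ne'
        (Eventually.of_forall hel)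
    · exact (continuous_const.mul (hc.comp hec)).inv₀ fun y => (hσpos _).ne'
    · apply hσm.injective
      rw [hel, hσT, hel]
    · apply hσm.injective
      rw [hel, hσ0]
  · have := (hγ.norm_deriv_pos (e.symm y)).ne'
    field_simp

/-- Constant speed makes the new derivative `l • τ ∘ φ`, so no second derivative of `φ` is needed.
-/
theorem MemH2imm.comp {γ : ℝ → Plane} (hγ : MemH2imm γ) {φ σ φ' : ℝ → ℝ} {l : ℝ}
    (h : IsReparam φ σ φ') (hl : ∀ y, φ' y * ‖deriv γ (φ y)‖ = l) :
    MemH2imm fun y => γ (φ y) := by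
  refine ⟨⟨h.periodic_comp hγ.mem_H2per.periodic, fun y => ?_, ?_⟩, fun y => ?_⟩
  · exact ((hγ.differentiable _).hasDerivAt.scomp y (h.hasDerivAt y)).differentiableAt
  · have : deriv (fun y => γ (φ y)) = fun y => l • tangent γ (φ y) := by
      funext y
      rw [h.deriv_comp, ← hl y, tangent, arcDeriv, smul_smul, mul_assoc,
        mul_inv_cancel₀ (hγ.norm_deriv_pos _).ne', mul_one]
    rw [this]
    exact (h.memH1per_comp hγ.memH1per_tangent).const_smul l
  · rw [h.deriv_comp]
    exact smul_ne_zero (h.pos y).ne' (hγ.regular _)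

/-! ### Invariance under translation and normalization -/

theorem integral_deriv_eq_zero {γ : ℝ → Plane} (hd : Differentiable ℝ γ)
    (hc : Continuous (deriv γ)) (hp : Function.Periodic γ (2 * Real.pi)) :
    ∫ x in (0 : ℝ)..(2 * Real.pi), deriv γ x = 0 := by
  rw [intervalIntegral.integral_deriv_eq_sub (fun x _ => hd x) (hc.intervalIntegrable _ _)]
  have := hp 0
  rw [zero_add] at this
  rw [this, sub_self]

theorem continuous_rot : Continuous rot := by
  unfold rot
  fun_prop

theorem inner_rot_left (v w : Plane) : ⟪v, rot w⟫ = -⟪rot v, w⟫ := by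
  simp [rot, PiLp.inner_apply, Fin.sum_univ_two]

/-- The additional term pairs a constant vector with the integral of `γ'` over a period, which
vanishes. -/
theorem signedArea_add_const {γ : ℝ → Plane} (hγ : MemH2imm γ) (c : Plane) :
    signedArea (fun x => γ x + c) = signedArea γ := by
  have hr : Continuous fun x => rot (deriv γ x) := continuous_rot.comp hγ.continuous_deriv
  have h1 : ∫ x in (0 : ℝ)..(2 * Real.pi), ⟪c, rot (deriv γ x)⟫ = 0 := by
    simp only [inner_rot_left]
    rw [intervalIntegral.integral_neg, periodIntegral, integral_inner, ← periodIntegral,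
      integral_deriv_eq_zero hγ.differentiable hγ.continuous_deriv hγ.mem_H2per.periodic,
      inner_zero_right, neg_zero]
    exact intervalIntegrable_period.1 (hγ.continuous_deriv.intervalIntegrable _ _)
  simp only [signedArea, deriv_add_const', inner_add_left]
  rw [intervalIntegral.integral_add, h1, add_zero]
  · exact (hγ.differentiable.continuous.inner hr).intervalIntegrable _ _
  · exact (continuous_const.inner hr).intervalIntegrable _ _

theorem energyLM_add_const (δ lam : ℝ) (γ η : ℝ → Plane) (c : Plane) :
    energyLM δ lam (fun x => γ x + c, η) = energyLM δ lam (γ, η) := by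
  have ht : tangent (fun x => γ x + c) = tangent γ := by
    funext x; simp [tangent, arcDeriv]
  simp only [energyLM, curveIntegral, length, curvature, curveDiv, curveGrad, normal, arcDeriv, ht,
    deriv_add_const']

theorem MemH2imm.add_const {γ : ℝ → Plane} (hγ : MemH2imm γ) (c : Plane) :
    MemH2imm fun x => γ x + c := by
  refine ⟨⟨fun x => ?_, hγ.differentiable.add_const c, ?_⟩, fun x => ?_⟩
  · simp only [hγ.mem_H2per.periodic x]
  · rw [deriv_add_const']; exact hγ.memH1per_deriv
  · rw [deriv_add_const']; exact hγ.regular x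

theorem admissible_add_const {A₀ : ℝ} {γ η : ℝ → Plane} (h : (γ, η) ∈ admissible A₀) (c : Plane) :
    (fun x => γ x + c, η) ∈ admissible A₀ :=
  ⟨h.1.add_const c, h.2.1, (signedArea_add_const h.1 c).trans h.2.2.1, h.2.2.2⟩

/-- Every admissible pair can be reparametrized by arc length and translated, without changing its
energy. -/
theorem exists_constSpeed (δ lam : ℝ) {A₀ : ℝ} {p : (ℝ → Plane) × (ℝ → Plane)}
    (hp : p ∈ admissible A₀) : ∃ γ η : ℝ → Plane, (γ, η) ∈ admissible A₀ ∧
      energyLM δ lam (γ, η) = energyLM δ lam p ∧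
      (∀ x, ‖deriv γ x‖ = length γ / (2 * Real.pi)) ∧ γ 0 = 0 := by
  obtain ⟨γ, η⟩ := p
  obtain ⟨hγ, hη, hA, h1⟩ := hp
  obtain ⟨φ, σ, φ', h, hl⟩ := MemH2imm.exists_isReparam hγ
  have hadm : (fun y => γ (φ y), fun y => η (φ y)) ∈ admissible A₀ :=
    ⟨MemH2imm.comp hγ h hl, h.memH1per_comp hη, (h.signedArea_comp γ).trans hA, fun x => h1 _⟩
  refine ⟨fun y => γ (φ y) + -γ (φ 0), fun y => η (φ y), admissible_add_const hadm _, ?_,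
    fun x => ?_, by simp⟩
  · rw [energyLM_add_const, h.energyLM_comp]
  · rw [deriv_add_const', h.deriv_comp, norm_smul, Real.norm_eq_abs, abs_of_pos (h.pos x), hl x]
    congr 1
    change length γ = _
    rw [← h.length_comp]
    simp only [length, deriv_add_const']

/-! ### Weak convergence and compactness -/

/-- Bounded sequences in a separable Hilbert space have weakly convergent subsequences. -/
theorem exists_weak_subseq {H : Type*} [NormedAddCommGroup H] [InnerProductSpace ℝ H]
    [CompleteSpace H] [TopologicalSpace.SeparableSpace H] {f : ℕ → H} {C : ℝ}
    (hf : ∀ k, ‖f k‖ ≤ C) : ∃ u : H, ∃ s : ℕ → ℕ, StrictMono s ∧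
      ∀ w, Tendsto (fun k => ⟪f (s k), w⟫) atTop (𝓝 ⟪u, w⟫) := by
  -- Sequential Banach–Alaoglu in the dual, transferred to `H` by the Riesz isometry.
  have hc := WeakDual.isSeqCompact_closedBall ℝ H 0 C
  obtain ⟨F, -, s, hs, hF⟩ := hc
    (x := fun k => StrongDual.toWeakDual (InnerProductSpace.toDual ℝ H (f k)))
    (fun k => by simpa using hf k)
  refine ⟨(InnerProductSpace.toDual ℝ H).symm (WeakDual.toStrongDual F), s, hs, fun w => ?_⟩
  have := ((WeakDual.eval_continuous w).tendsto F).comp hF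
  simpa using! this

/-- Weak convergence in `L²` over one period. -/
def WeakLim (U : ℕ → ℝ → Plane) (u : ℝ → Plane) : Prop :=
  ∀ Φ : ℝ → Plane, MemLp Φ 2 periodMeasure →
    Tendsto (fun k => ∫ x, ⟪U k x, Φ x⟫ ∂periodMeasure) atTop (𝓝 (∫ x, ⟪u x, Φ x⟫ ∂periodMeasure))

theorem WeakLim.comp {U : ℕ → ℝ → Plane} {u : ℝ → Plane} (h : WeakLim U u) {s : ℕ → ℕ}
    (hs : StrictMono s) : WeakLim (fun k => U (s k)) u :=
  fun Φ hΦ => (h Φ hΦ).comp hs.tendsto_atTop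

theorem WeakLim.congr {U : ℕ → ℝ → Plane} {u v : ℝ → Plane} (h : WeakLim U u)
    (huv : u =ᵐ[periodMeasure] v) : WeakLim U v := fun Φ hΦ => by
  have : ∫ x, ⟪v x, Φ x⟫ ∂periodMeasure = ∫ x, ⟪u x, Φ x⟫ ∂periodMeasure := by
    refine integral_congr_ae ?_
    filter_upwards [huv] with x hx
    rw [hx]
  rw [this]
  exact h Φ hΦ

theorem inner_toLp {f g : ℝ → Plane} (hf : MemLp f 2 periodMeasure) (hg : MemLp g 2 periodMeasure) :
    ⟪hf.toLp f, hg.toLp g⟫ = ∫ x, ⟪f x, g x⟫ ∂periodMeasure := by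
  rw [L2.inner_def]
  refine integral_congr_ae ?_
  filter_upwards [hf.coeFn_toLp, hg.coeFn_toLp] with x h1 h2
  rw [h1, h2]

theorem norm_sq_toLp {f : ℝ → Plane} (hf : MemLp f 2 periodMeasure) :
    ‖hf.toLp f‖ ^ 2 = ∫ x, ‖f x‖ ^ 2 ∂periodMeasure := by
  rw [← real_inner_self_eq_norm_sq, inner_toLp]
  simp only [real_inner_self_eq_norm_sq]

theorem MemLp.integrable_norm_sq {f : ℝ → Plane} (hf : MemLp f 2 periodMeasure) :
    Integrable (fun x => ‖f x‖ ^ 2) periodMeasure :=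
  (memLp_two_iff_integrable_sq_norm hf.1).1 hf

theorem MemLp.integrable_inner {f g : ℝ → Plane} (hf : MemLp f 2 periodMeasure)
    (hg : MemLp g 2 periodMeasure) : Integrable (fun x => ⟪f x, g x⟫) periodMeasure := by
  refine (L2.integrable_inner (𝕜 := ℝ) (hf.toLp f) (hg.toLp g)).congr ?_
  filter_upwards [hf.coeFn_toLp, hg.coeFn_toLp] with x h1 h2
  rw [h1, h2]

theorem exists_weakLim {U : ℕ → ℝ → Plane} {C : ℝ} (hU : ∀ k, MemLp (U k) 2 periodMeasure)
    (hC : ∀ k, ∫ x, ‖U k x‖ ^ 2 ∂periodMeasure ≤ C) :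
    ∃ u, MemLp u 2 periodMeasure ∧ ∃ s : ℕ → ℕ, StrictMono s ∧ WeakLim (fun k => U (s k)) u := by
  have : Fact ((2 : ENNReal) ≠ ⊤) := ⟨ENNReal.ofNat_ne_top⟩
  obtain ⟨u, s, hs, h⟩ := exists_weak_subseq (f := fun k => (hU k).toLp (U k)) (C := √C)
    fun k => Real.le_sqrt_of_sq_le ((norm_sq_toLp (hU k)).trans_le (hC k))
  refine ⟨u, Lp.memLp u, s, hs, fun Φ hΦ => ?_⟩
  have := h (hΦ.toLp Φ)
  simp only [inner_toLp] at this
  rwa [← Lp.toLp_coeFn u (Lp.memLp u), inner_toLp] at this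

/-- The product of a weakly and a strongly convergent sequence. -/
theorem WeakLim.tendsto_inner {U Φ : ℕ → ℝ → Plane} {u φ : ℝ → Plane} {F : ℝ → ℝ} {C : ℝ}
    (h : WeakLim U u) (hU : ∀ k, MemLp (U k) 2 periodMeasure)
    (hC : ∀ k, ∫ x, ‖U k x‖ ^ 2 ∂periodMeasure ≤ C)
    (hF : MemLp F 2 periodMeasure) (hΦ : ∀ k, AEStronglyMeasurable (Φ k) periodMeasure)
    (hφ : AEStronglyMeasurable φ periodMeasure)
    (hb : ∀ k, ∀ᵐ x ∂periodMeasure, ‖Φ k x‖ ≤ F x)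
    (hlim : ∀ᵐ x ∂periodMeasure, Tendsto (fun k => Φ k x) atTop (𝓝 (φ x))) :
    Tendsto (fun k => ∫ x, ⟪U k x, Φ k x⟫ ∂periodMeasure) atTop
      (𝓝 (∫ x, ⟪u x, φ x⟫ ∂periodMeasure)) := by
  have hφF : ∀ᵐ x ∂periodMeasure, ‖φ x‖ ≤ F x := by
    filter_upwards [ae_all_iff.2 hb, hlim] with x h1 h2
    exact le_of_tendsto h2.norm (Eventually.of_forall h1)
  have hΦm : ∀ k, MemLp (Φ k) 2 periodMeasure := fun k => hF.mono' (hΦ k) (hb k)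
  have hφm : MemLp φ 2 periodMeasure := hF.mono' hφ hφF
  have hd : ∀ k, MemLp (fun x => Φ k x - φ x) 2 periodMeasure := fun k => (hΦm k).sub hφm
  -- Domination by `4F²` upgrades pointwise convergence of `Φ k` to strong `L²` convergence.
  have hsq : Tendsto (fun k => ∫ x, ‖Φ k x - φ x‖ ^ 2 ∂periodMeasure) atTop (𝓝 0) := by
    have := tendsto_integral_of_dominated_convergence (μ := periodMeasure)
      (F := fun k x => ‖Φ k x - φ x‖ ^ 2) (f := fun _ => (0 : ℝ)) (fun x => 4 * F x ^ 2)
      (fun k => (hd k).1.norm.pow 2) (hF.integrable_sq.const_mul 4) (fun k => ?_) ?_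
    · simpa using this
    · filter_upwards [hb k, hφF] with x h1 h2
      rw [Real.norm_eq_abs, abs_of_nonneg (by positivity)]
      have h3 := (norm_sub_le (Φ k x) (φ x)).trans (add_le_add h1 h2)
      calc _ ≤ (F x + F x) ^ 2 := by gcongr
        _ = _ := by ring
    · filter_upwards [hlim] with x hx
      simpa using ((hx.sub_const (φ x)).norm.pow 2)
  -- By Cauchy–Schwarz the error of replacing `Φ k` by `φ` vanishes; weak convergence against the
  -- fixed `φ` does the rest.
  have hzero : Tendsto (fun k => ∫ x, ⟪U k x, Φ k x - φ x⟫ ∂periodMeasure) atTop (𝓝 0) := by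
    refine squeeze_zero_norm (a := fun k => √C * √(∫ x, ‖Φ k x - φ x‖ ^ 2 ∂periodMeasure))
      (fun k => ?_) ?_
    · rw [← inner_toLp (hU k) (hd k)]
      refine (norm_inner_le_norm _ _).trans ?_
      gcongr
      · exact Real.le_sqrt_of_sq_le ((norm_sq_toLp (hU k)).trans_le (hC k))
      · exact Real.le_sqrt_of_sq_le (norm_sq_toLp (hd k)).le
    · simpa using (hsq.sqrt).const_mul (√C)
  have := hzero.add (h φ hφm)
  rw [zero_add] at this
  refine this.congr fun k => ?_
  rw [← integral_add (MemLp.integrable_inner (hU k) (hd k)) (MemLp.integrable_inner (hU k) hφm)]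
  simp only [← inner_add_right, sub_add_cancel]

/-- Each component of the integral is the `L²` pairing with the indicator of `(0, x]` times a basis
vector. -/
theorem tendsto_integral_of_weakLim {U : ℕ → ℝ → Plane} {u : ℝ → Plane}
    (h : WeakLim U u) (hU : ∀ k, MemLp (U k) 2 periodMeasure) (hu : MemLp u 2 periodMeasure)
    {x : ℝ} (hx : x ∈ Set.Icc 0 (2 * Real.pi)) :
    Tendsto (fun k => ∫ t in (0 : ℝ)..x, U k t) atTop (𝓝 (∫ t in (0 : ℝ)..x, u t)) := by
  have key : ∀ (V : ℝ → Plane), MemLp V 2 periodMeasure → ∀ i, (∫ t in (0 : ℝ)..x, V t) i =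
      ∫ t, ⟪V t, (Set.Ioc 0 x).indicator (fun _ => EuclideanSpace.single i (1 : ℝ)) t⟫
        ∂periodMeasure := fun V hV i => by
    have hVi : Integrable V (volume.restrict (Set.Ioc 0 x)) :=
      (hV.integrable one_le_two).mono_measure
        (Measure.restrict_mono (Set.Ioc_subset_Ioc_right hx.2) le_rfl)
    have h1 : ∀ t, ⟪V t, (Set.Ioc 0 x).indicator (fun _ => EuclideanSpace.single i (1 : ℝ)) t⟫
        = (Set.Ioc 0 x).indicator (fun t => ⟪EuclideanSpace.single i (1 : ℝ), V t⟫) t := fun t => by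
      by_cases ht : t ∈ Set.Ioc 0 x
      · rw [Set.indicator_of_mem ht, Set.indicator_of_mem ht, real_inner_comm]
      · rw [Set.indicator_of_notMem ht, Set.indicator_of_notMem ht, inner_zero_right]
    simp only [h1]
    rw [integral_indicator measurableSet_Ioc, periodMeasure,
      Measure.restrict_restrict_of_subset (Set.Ioc_subset_Ioc_right hx.2), integral_inner hVi,
      intervalIntegral.integral_of_le hx.1, EuclideanSpace.inner_single_left]
    simp
  have hΦ : ∀ i : Fin 2, MemLp ((Set.Ioc 0 x).indicator
      (fun _ => EuclideanSpace.single i (1 : ℝ))) 2 periodMeasure := fun i =>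
    (memLp_const (EuclideanSpace.single i (1 : ℝ))).indicator measurableSet_Ioc
  have h2 : Tendsto (fun k => WithLp.ofLp (∫ t in (0 : ℝ)..x, U k t)) atTop
      (𝓝 (WithLp.ofLp (∫ t in (0 : ℝ)..x, u t))) := by
    refine tendsto_pi_nhds.2 fun i => ?_
    rw [key u hu i]
    exact (h _ (hΦ i)).congr fun k => (key (U k) (hU k) i).symm
  exact ((PiLp.continuous_toLp 2 _).tendsto _).comp h2

/-- Compactness in `H¹_per`: bounded sequences have subsequences that converge pointwise, with
weakly convergent derivatives. -/
theorem exists_H1_limit {f : ℕ → ℝ → Plane} {M C : ℝ} (hf : ∀ k, MemH1per (f k))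
    (hM : ∀ k, ‖f k 0‖ ≤ M) (hC : ∀ k, ∫ x, ‖deriv (f k) x‖ ^ 2 ∂periodMeasure ≤ C) :
    ∃ g, MemH1per g ∧ ∃ s : ℕ → ℕ, StrictMono s ∧
      (∀ x, Tendsto (fun k => f (s k) x) atTop (𝓝 (g x))) ∧
      WeakLim (fun k => deriv (f (s k))) (deriv g) := by
  obtain ⟨u, hu, s, hs, hw⟩ := exists_weakLim (fun k => (hf k).memLp) hC
  obtain ⟨a, -, r, hr, ha⟩ := (isCompact_closedBall (0 : Plane) M).tendsto_subseq
    (x := fun k => f (s k) 0) fun k => by simpa using hM (s k)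
  have hw' : WeakLim (fun k => deriv (f (s (r k)))) u := hw.comp hr
  have hI : ∀ x ∈ Set.Icc 0 (2 * Real.pi),
      Tendsto (fun k => f (s (r k)) x) atTop (𝓝 (a + ∫ t in (0 : ℝ)..x, u t)) := fun x hx =>
    (ha.add (tendsto_integral_of_weakLim hw' (fun k => (hf _).memLp) hu hx)).congr
      fun k => ((hf _).eq_add_integral hx).symm
  -- Off the period, periodicity reduces `x` to its representative in `[0, 2π)`.
  have hex : ∀ x, ∃ b, Tendsto (fun k => f (s (r k)) x) atTop (𝓝 b) := fun x => by
    have hy := toIcoMod_mem_Ico' Real.two_pi_pos x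
    refine ⟨_, (hI _ (Set.Ico_subset_Icc_self hy)).congr fun k => ?_⟩
    rw [← self_sub_toIcoDiv_zsmul, (hf _).periodic.sub_zsmul_eq]
  choose g hg using hex
  have hgI : ∀ x ∈ Set.Icc 0 (2 * Real.pi), g x = a + ∫ t in (0 : ℝ)..x, u t := fun x hx =>
    tendsto_nhds_unique (hg x) (hI x hx)
  have hg0 : g 0 = a := tendsto_nhds_unique (hg 0) ha
  have hgp : Function.Periodic g (2 * Real.pi) := fun x =>
    tendsto_nhds_unique (hg _) ((hg x).congr fun k => ((hf _).periodic x).symm)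
  have hgI' : ∀ x ∈ Set.Icc 0 (2 * Real.pi), g x = g 0 + ∫ t in (0 : ℝ)..x, u t := by
    rwa [hg0]
  exact ⟨g, MemH1per.of_primitive hgp hu hgI', fun k => s (r k), hs.comp hr, hg,
    hw'.congr (MemH1per.congr_deriv_ae hu hgI').symm⟩

/-! ### The energy at constant speed and its coercivity -/

/-- The curvature-divergence density `κ + δ div_γ η` of a curve of constant speed `l` in terms of
`g = ∂ₓγ`, `u = ∂ₓ²γ` and `v = ∂ₓη`. -/
def bend (δ l : ℝ) (u g v : ℝ → Plane) (x : ℝ) : ℝ :=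
  l⁻¹ ^ 3 * ⟪u x, rot (g x)⟫ + δ * l⁻¹ ^ 2 * ⟪v x, g x⟫

theorem frobeniusSq_curveGrad (γ η : ℝ → Plane) (x : ℝ) :
    frobeniusSq (curveGrad γ η x) = ‖arcDeriv γ η x‖ ^ 2 * ‖tangent γ x‖ ^ 2 := by
  simp only [frobeniusSq, curveGrad, EuclideanSpace.norm_sq_eq, Fin.sum_univ_two, Matrix.of_apply,
    Real.norm_eq_abs, sq_abs]
  ring

theorem length_constSpeed {γ : ℝ → Plane} {l : ℝ} (hl : ∀ x, ‖deriv γ x‖ = l) :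
    length γ = 2 * Real.pi * l := by
  simp [length, hl]

/-- At constant speed every `∂_s` is `l⁻¹ ∂ₓ`, so only powers of `l` remain; the identities for the
densities hold at every point. -/
theorem energyLM_constSpeed (δ lam : ℝ) {γ : ℝ → Plane} (η : ℝ → Plane) {l : ℝ} (hl0 : 0 < l)
    (hl : ∀ x, ‖deriv γ x‖ = l) : energyLM δ lam (γ, η) =
      l / 2 * ∫ x, bend δ l (deriv (deriv γ)) (deriv γ) (deriv η) x ^ 2 ∂periodMeasure
      + lam / (2 * l) * ∫ x, ‖deriv η x‖ ^ 2 ∂periodMeasure + 2 * Real.pi * l := by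
  have ht : tangent γ = fun x => l⁻¹ • deriv γ x := funext fun x => by
    rw [tangent, arcDeriv, hl]
  have h1 : ∀ x, curvature γ x + δ * curveDiv γ η x =
      bend δ l (deriv (deriv γ)) (deriv γ) (deriv η) x := fun x => by
    simp only [curvature, curveDiv, normal, bend, arcDeriv, ht, hl, rot_smul,
      deriv_fun_const_smul_field, real_inner_smul_left, real_inner_smul_right]
    ring
  have h2 : ∀ x, frobeniusSq (curveGrad γ η x) = l⁻¹ ^ 2 * ‖deriv η x‖ ^ 2 := fun x => by
    rw [frobeniusSq_curveGrad, ht, arcDeriv, hl, norm_smul, norm_smul, hl, Real.norm_eq_abs,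
      abs_of_pos (inv_pos.2 hl0), inv_mul_cancel₀ hl0.ne']
    ring
  simp only [energyLM, curveIntegral, h1, h2, hl, length_constSpeed hl]
  rw [intervalIntegral.integral_mul_const, intervalIntegral.integral_mul_const,
    intervalIntegral.integral_const_mul, periodIntegral, periodIntegral]
  field_simp

/-- Pythagoras: `w` and `Jw` are orthogonal and of equal length. -/
theorem inner_rot_sq_add_inner_sq (v w : Plane) :
    ⟪v, rot w⟫ ^ 2 + ⟪v, w⟫ ^ 2 = ‖v‖ ^ 2 * ‖w‖ ^ 2 := by
  simp [rot, PiLp.inner_apply, EuclideanSpace.norm_sq_eq, Fin.sum_univ_two]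
  ring

/-- Differentiate the constant `‖g‖²`; where `g` is not differentiable its `deriv` is zero. -/
theorem inner_deriv_self_of_norm_const {g : ℝ → Plane} {l : ℝ} (hg : ∀ x, ‖g x‖ = l) (x : ℝ) :
    ⟪deriv g x, g x⟫ = 0 := by
  by_cases hd : DifferentiableAt ℝ g x
  · have h1 := hd.hasDerivAt.norm_sq
    have h2 : HasDerivAt (fun x => ‖g x‖ ^ 2) 0 x := by
      simp only [hg]; exact hasDerivAt_const _ _
    have := h1.unique h2
    rw [real_inner_comm]
    linarith
  · rw [deriv_zero_of_not_differentiableAt hd, inner_zero_left]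

theorem memLp_bend (δ l : ℝ) {u g v : ℝ → Plane} (hu : MemLp u 2 periodMeasure)
    (hg : Continuous g) (hv : MemLp v 2 periodMeasure) {M : ℝ} (hM : ∀ x, ‖g x‖ ≤ M) :
    MemLp (bend δ l u g v) 2 periodMeasure := by
  have h1 : MemLp (fun x => ⟪u x, rot (g x)⟫) 2 periodMeasure :=
    hu.of_le_mul (c := M) (hu.1.inner (continuous_rot.comp hg).aestronglyMeasurable)
      (Eventually.of_forall fun x => (norm_inner_le_norm _ _).trans (by
        rw [norm_rot, mul_comm]; gcongr; exact hM x))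
  have h2 : MemLp (fun x => ⟪v x, g x⟫) 2 periodMeasure :=
    hv.of_le_mul (c := M) (hv.1.inner hg.aestronglyMeasurable)
      (Eventually.of_forall fun x => (norm_inner_le_norm _ _).trans (by
        rw [mul_comm]; gcongr; exact hM x))
  exact (h1.const_mul _).add (h2.const_mul _)

/-- Cauchy–Schwarz against the constant `1`, read off from the nonnegative variance of `f` about its
mean `m`. -/
theorem sq_integral_le {f : ℝ → ℝ} (hf : MemLp f 2 periodMeasure) :
    (∫ x, f x ∂periodMeasure) ^ 2 ≤ 2 * Real.pi * ∫ x, f x ^ 2 ∂periodMeasure := by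
  set m := (∫ x, f x ∂periodMeasure) / (2 * Real.pi) with hm
  have hi := hf.integrable one_le_two
  have h0 : 0 ≤ ∫ x, (f x - m) ^ 2 ∂periodMeasure := integral_nonneg fun x => sq_nonneg _
  have h1 : ∫ x, (f x - m) ^ 2 ∂periodMeasure =
      ∫ x, f x ^ 2 ∂periodMeasure - 2 * m * ∫ x, f x ∂periodMeasure + 2 * Real.pi * m ^ 2 := by
    have : ∀ x, (f x - m) ^ 2 = f x ^ 2 - 2 * m * f x + m ^ 2 := fun x => by ring
    simp only [this]
    rw [integral_add (f := fun x => f x ^ 2 - 2 * m * f x)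
      (hf.integrable_sq.sub (hi.const_mul _)) (integrable_const _),
      integral_sub hf.integrable_sq (hi.const_mul _), integral_const_mul, integral_const]
    simp [Measure.real, Real.pi_pos.le]
  have h2 : ∫ x, f x ∂periodMeasure = 2 * Real.pi * m := by
    rw [hm]; field_simp
  rw [h1, h2] at h0
  rw [h2]
  nlinarith [Real.two_pi_pos]

/-- A Poincaré inequality: a curve of constant norm `l` and mean zero has derivative of size at
least `l`. -/
theorem le_integral_norm_deriv {g : ℝ → Plane} {l : ℝ} (hg : MemH1per g) (hl : ‖g 0‖ = l)
    (h0 : ∫ x in (0 : ℝ)..(2 * Real.pi), g x = 0) :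
    l ≤ ∫ x, ‖deriv g x‖ ∂periodMeasure := by
  have hi := memLp_two_period_intervalIntegrable hg.memLp
  have hgi : IntervalIntegrable g volume 0 (2 * Real.pi) := hg.continuous.intervalIntegrable _ _
  -- No value of `g` is farther than `∫ ‖g'‖` from `g 0`, while the average of `g - g 0` is `-g 0`,
  -- of norm `l`.
  have hb : ∀ x ∈ Set.uIoc 0 (2 * Real.pi), ‖g x - g 0‖ ≤ ∫ x, ‖deriv g x‖ ∂periodMeasure := by
    intro x hx
    rw [Set.uIoc_of_le two_pi_nonneg] at hx
    rw [hg.eq_add_integral (Set.Ioc_subset_Icc_self hx), add_sub_cancel_left, ← periodIntegral]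
    refine (intervalIntegral.norm_integral_le_integral_norm hx.1.le).trans ?_
    exact intervalIntegral.integral_mono_interval le_rfl hx.1.le hx.2
      (Eventually.of_forall fun _ => norm_nonneg _) hi.norm
  have h1 := intervalIntegral.norm_integral_le_of_norm_le_const hb
  rw [intervalIntegral.integral_sub hgi intervalIntegrable_const, h0, zero_sub, norm_neg,
    intervalIntegral.integral_const, norm_smul, hl, sub_zero, Real.norm_eq_abs,
    abs_of_pos Real.two_pi_pos, mul_comm] at h1
  exact le_of_mul_le_mul_right h1 Real.two_pi_pos

/-- Coercivity of the energy on curves of constant speed. -/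
theorem coercive {δ lam A₀ M : ℝ} (hlam : 0 < lam) {γ η : ℝ → Plane} {l : ℝ}
    (h : (γ, η) ∈ admissible A₀) (hl : ∀ x, ‖deriv γ x‖ = l)
    (hE : energyLM δ lam (γ, η) ≤ M) :
    2 * Real.pi * l ≤ M ∧
    ∫ x, ‖deriv η x‖ ^ 2 ∂periodMeasure ≤ 2 * M * l / lam ∧
    ∫ x, ‖deriv (deriv γ) x‖ ^ 2 ∂periodMeasure ≤ 4 * M * (1 + δ ^ 2 / lam) * l ^ 3 ∧
    1 ≤ 2 * Real.pi * (4 * M * (1 + δ ^ 2 / lam)) * l := by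
  obtain ⟨hγ, hη, -, -⟩ := h
  simp only at hγ hη
  have hl0 : 0 < l := hl 0 ▸ hγ.norm_deriv_pos 0
  set u := deriv (deriv γ)
  set g := deriv γ
  set v := deriv η
  have hu : MemLp u 2 periodMeasure := hγ.memH1per_deriv.memLp
  have hv : MemLp v 2 periodMeasure := hη.memLp
  have hW : MemLp (bend δ l u g v) 2 periodMeasure :=
    memLp_bend δ l hu hγ.continuous_deriv hv fun x => (hl x).le
  rw [energyLM_constSpeed δ lam η hl0 hl] at hE
  have i1 : 0 ≤ ∫ x, bend δ l u g v x ^ 2 ∂periodMeasure := integral_nonneg fun x => sq_nonneg _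
  have i2 : 0 ≤ ∫ x, ‖v x‖ ^ 2 ∂periodMeasure := integral_nonneg fun x => sq_nonneg _
  have e1 : 0 ≤ l / 2 * ∫ x, bend δ l u g v x ^ 2 ∂periodMeasure := by positivity
  have e2 : 0 ≤ lam / (2 * l) * ∫ x, ‖v x‖ ^ 2 ∂periodMeasure := by positivity
  have e3 : 0 ≤ 2 * Real.pi * l := by positivity
  have hV : ∫ x, ‖v x‖ ^ 2 ∂periodMeasure ≤ 2 * M * l / lam := by
    have : lam / (2 * l) * ∫ x, ‖v x‖ ^ 2 ∂periodMeasure ≤ M := by linarith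
    rw [le_div_iff₀ hlam]
    rw [div_mul_eq_mul_div, div_le_iff₀ (by positivity)] at this
    linarith
  have hWi : l * ∫ x, bend δ l u g v x ^ 2 ∂periodMeasure ≤ 2 * M := by linarith
  have hpt : ∀ x, ‖u x‖ ^ 2 ≤
      2 * l ^ 4 * bend δ l u g v x ^ 2 + 2 * δ ^ 2 * l ^ 2 * ‖v x‖ ^ 2 := fun x => by
    have h1 := inner_rot_sq_add_inner_sq (u x) (g x)
    rw [inner_deriv_self_of_norm_const hl x, hl x] at h1
    have h2 : ⟪v x, g x⟫ ^ 2 ≤ ‖v x‖ ^ 2 * l ^ 2 := by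
      rw [← mul_pow, ← hl x]
      exact sq_le_sq' (neg_le_of_abs_le (abs_real_inner_le_norm _ _)) (real_inner_le_norm _ _)
    have h3 : ⟪u x, rot (g x)⟫ = l ^ 3 * bend δ l u g v x - δ * l * ⟪v x, g x⟫ := by
      rw [bend]; field_simp; ring
    have h4 : ‖u x‖ ^ 2 * l ^ 2 ≤
        (2 * l ^ 4 * bend δ l u g v x ^ 2 + 2 * δ ^ 2 * l ^ 2 * ‖v x‖ ^ 2) * l ^ 2 := by
      have h5 : δ ^ 2 * l ^ 2 * ⟪v x, g x⟫ ^ 2 ≤ δ ^ 2 * l ^ 2 * (‖v x‖ ^ 2 * l ^ 2) := by gcongr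
      rw [h3] at h1
      -- This square gives `(a - b)² ≤ 2a² + 2b²`; as `γ''` is orthogonal to `γ'`, its normal
      -- component is all of it.
      nlinarith [sq_nonneg (l ^ 3 * bend δ l u g v x + δ * l * ⟪v x, g x⟫)]
    exact le_of_mul_le_mul_right h4 (by positivity)
  have hU : ∫ x, ‖u x‖ ^ 2 ∂periodMeasure ≤ 4 * M * (1 + δ ^ 2 / lam) * l ^ 3 := by
    calc ∫ x, ‖u x‖ ^ 2 ∂periodMeasure
        ≤ ∫ x, (2 * l ^ 4 * bend δ l u g v x ^ 2 + 2 * δ ^ 2 * l ^ 2 * ‖v x‖ ^ 2)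
          ∂periodMeasure := integral_mono (MemLp.integrable_norm_sq hu)
            ((hW.integrable_sq.const_mul _).add ((MemLp.integrable_norm_sq hv).const_mul _)) hpt
      _ = 2 * l ^ 3 * (l * ∫ x, bend δ l u g v x ^ 2 ∂periodMeasure) +
          2 * δ ^ 2 * l ^ 2 * ∫ x, ‖v x‖ ^ 2 ∂periodMeasure := by
        rw [integral_add (hW.integrable_sq.const_mul _)
          ((MemLp.integrable_norm_sq hv).const_mul _), integral_const_mul, integral_const_mul]
        ring
      _ ≤ 2 * l ^ 3 * (2 * M) + 2 * δ ^ 2 * l ^ 2 * (2 * M * l / lam) := by gcongr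
      _ = _ := by field_simp; ring
  refine ⟨by linarith, hV, hU, ?_⟩
  have hp := le_integral_norm_deriv hγ.memH1per_deriv (hl 0)
    (integral_deriv_eq_zero hγ.differentiable hγ.continuous_deriv hγ.mem_H2per.periodic)
  have hcs := sq_integral_le hu.norm
  -- Poincaré and Cauchy–Schwarz bound `l²` by a multiple of `l³`; dividing by `l²` bounds `l` from
  -- below.
  have h6 : l ^ 2 ≤ 2 * Real.pi * (4 * M * (1 + δ ^ 2 / lam) * l ^ 3) := by
    calc l ^ 2 ≤ (∫ x, ‖u x‖ ∂periodMeasure) ^ 2 := by gcongr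
      _ ≤ _ := hcs
      _ ≤ _ := by gcongr
  have h7 : 1 * l ^ 2 ≤ 2 * Real.pi * (4 * M * (1 + δ ^ 2 / lam)) * l * l ^ 2 := by
    calc _ = l ^ 2 := one_mul _
      _ ≤ _ := h6
      _ = _ := by ring
  exact le_of_mul_le_mul_right h7 (by positivity)

/-! ### The circle and the figure eight as competitors -/

theorem MemH2imm.of_contDiff {γ : ℝ → Plane} (hp : Function.Periodic γ (2 * Real.pi))
    (hγ : ContDiff ℝ 2 γ) (h : ∀ x, deriv γ x ≠ 0) : MemH2imm γ := by
  refine ⟨⟨hp, hγ.differentiable two_ne_zero, MemH1per.of_contDiff (fun x => ?_) ?_⟩, h⟩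
  · have := deriv_comp_add_const γ (2 * Real.pi) x
    rw [← this]
    congr 1
    exact funext hp
  · exact (contDiff_succ_iff_deriv (n := 1).1 hγ).2.2

theorem normal_mem_admissible {A₀ : ℝ} {γ : ℝ → Plane} (hγ : MemH2imm γ)
    (hA : signedArea γ = A₀) : (γ, normal γ) ∈ admissible A₀ :=
  ⟨hγ, hγ.memH1per_normal, hA, hγ.norm_normal⟩

theorem hasDerivAt_plane {f g : ℝ → ℝ} {a b x : ℝ} (hf : HasDerivAt f a x)
    (hg : HasDerivAt g b x) : HasDerivAt (fun x => (!₂[f x, g x] : Plane)) !₂[a, b] x := by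
  have h : HasDerivAt (fun x => ![f x, g x]) ![a, b] x := by
    rw [hasDerivAt_pi]
    intro i
    fin_cases i
    · simpa using hf
    · simpa using hg
  exact ((PiLp.continuousLinearEquiv 2 ℝ fun _ : Fin 2 => ℝ).symm.hasFDerivAt (x := ![f x, g x])
    ).comp_hasDerivAt x h

theorem contDiff_plane {f g : ℝ → ℝ} (hf : ContDiff ℝ 2 f) (hg : ContDiff ℝ 2 g) :
    ContDiff ℝ 2 (fun x => (!₂[f x, g x] : Plane)) := by
  rw [contDiff_euclidean]
  intro i
  fin_cases i
  · simpa using hf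
  · simpa using hg

theorem inner_plane (a b c d : ℝ) : ⟪(!₂[a, b] : Plane), rot !₂[c, d]⟫ = b * c - a * d := by
  simp [rot, PiLp.inner_apply, Fin.sum_univ_two]
  ring

theorem circleOfArea_mem {A₀ : ℝ} (hA : A₀ ≠ 0) :
    (circleOfArea A₀, normal (circleOfArea A₀)) ∈ admissible A₀ := by
  set r := √(|A₀| / Real.pi) with hr
  have hr2 : r ^ 2 = |A₀| / Real.pi := Real.sq_sqrt (by positivity)
  have hr0 : 0 < r := Real.sqrt_pos.2 (div_pos (abs_pos.2 hA) Real.pi_pos)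
  have hs : Real.sign A₀ ^ 2 = 1 := by
    rcases Real.sign_apply_eq_of_ne_zero A₀ hA with h | h <;> rw [h] <;> norm_num
  have hd : ∀ x, deriv (circleOfArea A₀) x =
      !₂[r * -Real.sin x, Real.sign A₀ * r * Real.cos x] := fun x =>
    (hasDerivAt_plane ((Real.hasDerivAt_cos x).const_mul r)
      ((Real.hasDerivAt_sin x).const_mul (Real.sign A₀ * r))).deriv
  refine normal_mem_admissible (MemH2imm.of_contDiff (fun x => ?_) ?_ fun x h => ?_) ?_
  · simp [circleOfArea]
  · exact contDiff_plane (contDiff_const.mul Real.contDiff_cos)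
      (contDiff_const.mul Real.contDiff_sin)
  · rw [hd] at h
    have h0 := congrArg (fun v : Plane => v 0) h
    have h1 := congrArg (fun v : Plane => v 1) h
    have hs0 : Real.sign A₀ ≠ 0 := fun h => by simp [h] at hs
    simp [hr0.ne', hs0] at h0 h1
    have := Real.sin_sq_add_cos_sq x
    simp [h0, h1] at this
  · have : ∀ x, ⟪circleOfArea A₀ x, rot (deriv (circleOfArea A₀) x)⟫ = -(Real.sign A₀ * r ^ 2) :=
      fun x => by
        rw [hd, circleOfArea, inner_plane, ← hr]
        linear_combination (-Real.sign A₀ * r ^ 2) * Real.sin_sq_add_cos_sq x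
    simp only [signedArea, this]
    rw [intervalIntegral.integral_const, hr2, smul_eq_mul]
    have h3 : Real.sign A₀ * |A₀| = A₀ := by
      rcases hA.lt_or_gt with h | h
      · rw [Real.sign_of_neg h, abs_of_neg h]; ring
      · rw [Real.sign_of_pos h, abs_of_pos h]; ring
    field_simp
    linear_combination 2 * Real.pi * h3

/-- The integrand equals `2 sin³ x`: the two lobes of the figure eight have opposite orientation and
their areas cancel. -/
theorem integral_sin_even_eq_zero :
    ∫ x in (0 : ℝ)..(2 * Real.pi), (Real.sin (2 * x) * Real.cos x -
      Real.sin x * (2 * Real.cos (2 * x))) = 0 := by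
  have h : ∀ x, HasDerivAt (fun x : ℝ => 2 / 3 * Real.cos x ^ 3 - 2 * Real.cos x)
      (Real.sin (2 * x) * Real.cos x - Real.sin x * (2 * Real.cos (2 * x))) x := fun x => by
    have h1 := (((Real.hasDerivAt_cos x).pow 3).const_mul (2 / 3)).sub
      ((Real.hasDerivAt_cos x).const_mul 2)
    refine h1.congr_deriv ?_
    rw [Real.sin_two_mul, Real.cos_two_mul]
    push_cast
    ring
  rw [intervalIntegral.integral_eq_sub_of_hasDerivAt (fun x _ => h x)]
  · simp
  · exact Continuous.intervalIntegrable (by fun_prop) _ _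

theorem figureEight_mem : (figureEight, normal figureEight) ∈ admissible 0 := by
  have hd : ∀ x, deriv figureEight x = !₂[Real.cos x, 2 * Real.cos (2 * x)] := fun x => by
    have h2 : HasDerivAt (fun x : ℝ => Real.sin (2 * x)) (2 * Real.cos (2 * x)) x := by
      simpa [mul_comm] using ((hasDerivAt_id x).const_mul 2).sin
    exact (hasDerivAt_plane (Real.hasDerivAt_sin x) h2).deriv
  refine normal_mem_admissible (MemH2imm.of_contDiff (fun x => ?_) ?_ fun x h => ?_) ?_
  · have : 2 * (x + 2 * Real.pi) = 2 * x + (2 : ℕ) * (2 * Real.pi) := by push_cast; ring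
    simp only [figureEight, this, Real.sin_add_two_pi, Real.sin_add_nat_mul_two_pi]
  · exact contDiff_plane Real.contDiff_sin
      (Real.contDiff_sin.comp (contDiff_const.mul contDiff_id))
  · rw [hd] at h
    have h0 := congrArg (fun v : Plane => v 0) h
    have h1 := congrArg (fun v : Plane => v 1) h
    -- If `cos x = 0` then `cos 2x = -1`, so the two components never vanish together.
    simp [Real.cos_two_mul] at h0 h1
    simp [h0] at h1
  · simp only [signedArea, hd]
    simp only [figureEight, inner_plane]
    rw [integral_sin_even_eq_zero, mul_zero]

/-! ### Stability of the constraints -/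

theorem eq_zero_of_continuous_integral {f : ℝ → ℝ} (hf : Continuous f) (h0 : ∀ x, 0 ≤ f x)
    (hp : Function.Periodic f (2 * Real.pi))
    (hi : ∫ x in (0 : ℝ)..(2 * Real.pi), f x = 0) (x : ℝ) : f x = 0 := by
  obtain ⟨y, hy, h⟩ := exists_mem_period hp x
  rw [h]
  by_contra hne
  have := intervalIntegral.integral_pos Real.two_pi_pos hf.continuousOn (fun x _ => h0 x)
    ⟨y, Set.Ico_subset_Icc_self hy, (h0 y).lt_of_ne' hne⟩
  exact this.ne' hi

/-- The pointwise constraint passes to `L²` limits. -/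
theorem norm_eq_one_of_tendsto {ηk : ℕ → ℝ → Plane} {η : ℝ → Plane}
    (hk : ∀ k, MemH1per (ηk k)) (h1 : ∀ k x, ‖ηk k x‖ = 1) (hη : MemH1per η)
    (h : Tendsto (fun k => ∫ x in (0 : ℝ)..(2 * Real.pi), ‖ηk k x - η x‖ ^ 2) atTop (𝓝 0)) (x : ℝ) :
    ‖η x‖ = 1 := by
  have hc : Continuous fun x => (‖η x‖ - 1) ^ 2 := (hη.continuous.norm.sub continuous_const).pow 2
  have hle : ∫ x in (0 : ℝ)..(2 * Real.pi), (‖η x‖ - 1) ^ 2 ≤ 0 := by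
    refine ge_of_tendsto h (Eventually.of_forall fun k => ?_)
    refine intervalIntegral.integral_mono_on two_pi_nonneg (hc.intervalIntegrable _ _)
      ((((hk k).continuous.sub hη.continuous).norm.pow 2).intervalIntegrable _ _) fun x _ => ?_
    -- Writing `1` as `‖ηk k x‖` turns the claim into the reverse triangle inequality.
    rw [← h1 k x, ← sq_abs, abs_sub_comm]
    gcongr
    exact abs_norm_sub_norm_le _ _
  have h0 : ∫ x in (0 : ℝ)..(2 * Real.pi), (‖η x‖ - 1) ^ 2 = 0 :=
    le_antisymm hle (intervalIntegral.integral_nonneg two_pi_nonneg fun x _ => sq_nonneg _)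
  have := eq_zero_of_continuous_integral hc (fun x => sq_nonneg _)
    (fun x => by simp only [hη.periodic x]) h0 x
  exact sub_eq_zero.1 (pow_eq_zero_iff two_ne_zero |>.1 this)

/-- Expand the bilinear difference and split the two linear terms by Young's inequality. Only
squared distances remain, up to the error `ε`, so convergence of the squared `H¹` distance applies
directly. -/
theorem abs_inner_sub_inner_le {p q a b : Plane} {C ε : ℝ} (ha : ‖a‖ ≤ C) (hb : ‖b‖ ≤ C)
    (hε : 0 < ε) : |⟪p, rot q⟫ - ⟪a, rot b⟫| ≤
      ε + (1 + C ^ 2 / ε) * (‖p - a‖ ^ 2 + ‖q - b‖ ^ 2) := by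
  have e : ⟪p, rot q⟫ - ⟪a, rot b⟫ =
      ⟪p - a, rot (q - b)⟫ + ⟪p - a, rot b⟫ + ⟪a, rot (q - b)⟫ := by
    simp only [rot_sub, inner_sub_left, inner_sub_right]; ring
  have hC : 0 ≤ C := (norm_nonneg a).trans ha
  have h1 : |⟪p - a, rot (q - b)⟫| ≤ ‖p - a‖ * ‖q - b‖ := by
    simpa [norm_rot] using abs_real_inner_le_norm (p - a) (rot (q - b))
  have h2 : |⟪p - a, rot b⟫| ≤ ‖p - a‖ * C := by
    refine (abs_real_inner_le_norm _ _).trans ?_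
    rw [norm_rot]; gcongr
  have h3 : |⟪a, rot (q - b)⟫| ≤ C * ‖q - b‖ := by
    refine (abs_real_inner_le_norm _ _).trans ?_
    rw [norm_rot]; gcongr
  have h4 : ∀ t : ℝ, C * t ≤ ε / 2 + C ^ 2 / ε * t ^ 2 := fun t => by
    have h6 : ε / 2 + C ^ 2 / ε * t ^ 2 - C * t = ((ε / 2 - C * t) ^ 2 + ε ^ 2 / 4) / ε := by
      field_simp
      ring
    have : 0 ≤ ((ε / 2 - C * t) ^ 2 + ε ^ 2 / 4) / ε := by positivity
    linarith
  rw [e]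
  have h5 := abs_add_three ⟪p - a, rot (q - b)⟫ ⟪p - a, rot b⟫ ⟪a, rot (q - b)⟫
  nlinarith [h4 ‖p - a‖, h4 ‖q - b‖, sq_nonneg (‖p - a‖ - ‖q - b‖), sq_nonneg ‖p - a‖,
    sq_nonneg ‖q - b‖]

/-- The signed area is continuous with respect to strong convergence in `H¹`. -/
theorem tendsto_signedArea {γk : ℕ → ℝ → Plane} {γ : ℝ → Plane} (hk : ∀ k, MemH2imm (γk k))
    (hγ : MemH2imm γ)
    (h : Tendsto (fun k => ∫ x in (0 : ℝ)..(2 * Real.pi),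
      (‖γk k x - γ x‖ ^ 2 + ‖deriv (γk k) x - deriv γ x‖ ^ 2)) atTop (𝓝 0)) :
    Tendsto (fun k => signedArea (γk k)) atTop (𝓝 (signedArea γ)) := by
  obtain ⟨C₁, hC₁⟩ := bounded_of_periodic hγ.mem_H2per.periodic hγ.differentiable.continuous
  obtain ⟨C₂, hC₂⟩ := bounded_of_periodic hγ.memH1per_deriv.periodic hγ.continuous_deriv
  set C := max C₁ C₂
  have hint : ∀ {β : ℝ → Plane}, MemH2imm β →
      Continuous fun x => ⟪β x, rot (deriv β x)⟫ := fun hβ =>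
    hβ.differentiable.continuous.inner (continuous_rot.comp hβ.continuous_deriv)
  have hdc : ∀ k, Continuous fun x => ‖γk k x - γ x‖ ^ 2 + ‖deriv (γk k) x - deriv γ x‖ ^ 2 :=
    fun k => (((hk k).differentiable.continuous.sub hγ.differentiable.continuous).norm.pow 2).add
      (((hk k).continuous_deriv.sub hγ.continuous_deriv).norm.pow 2)
  refine Tendsto.const_mul _ ?_
  rw [Metric.tendsto_nhds]
  intro ε hε
  -- Chosen so that the constant error integrates to `ε / 2` over a period.
  set ε' := ε / (2 * (2 * Real.pi)) with hε'
  have hε0 : 0 < ε' := by positivity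
  have hev := (h.const_mul (1 + C ^ 2 / ε')).eventually
    (eventually_lt_nhds (b := ε / 2) (by simpa using half_pos hε))
  filter_upwards [hev] with k hk'
  rw [Real.dist_eq, ← intervalIntegral.integral_sub ((hint (hk k)).intervalIntegrable _ _)
    ((hint hγ).intervalIntegrable _ _)]
  calc _ ≤ ∫ x in (0 : ℝ)..(2 * Real.pi), |⟪γk k x, rot (deriv (γk k) x)⟫ -
          ⟪γ x, rot (deriv γ x)⟫| := intervalIntegral.abs_integral_le_integral_abs two_pi_nonneg
    _ ≤ ∫ x in (0 : ℝ)..(2 * Real.pi), (ε' + (1 + C ^ 2 / ε') *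
          (‖γk k x - γ x‖ ^ 2 + ‖deriv (γk k) x - deriv γ x‖ ^ 2)) := by
        refine intervalIntegral.integral_mono_on two_pi_nonneg
          (((hint (hk k)).sub (hint hγ)).abs.intervalIntegrable _ _)
          ((continuous_const.add (continuous_const.mul (hdc k))).intervalIntegrable _ _)
          fun x _ => abs_inner_sub_inner_le ((hC₁ x).trans (le_max_left _ _))
            ((hC₂ x).trans (le_max_right _ _)) hε0
    _ = ε / 2 + (1 + C ^ 2 / ε') * ∫ x in (0 : ℝ)..(2 * Real.pi),
          (‖γk k x - γ x‖ ^ 2 + ‖deriv (γk k) x - deriv γ x‖ ^ 2) := by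
        rw [intervalIntegral.integral_add intervalIntegrable_const
          (((hdc k).intervalIntegrable _ _).const_mul _),
          intervalIntegral.integral_const_mul, intervalIntegral.integral_const, smul_eq_mul, hε']
        congr 1
        field_simp
        ring
    _ < ε := by linarith

theorem mem_admissible_of_tendsto {A₀ : ℝ} {γk ηk : ℕ → ℝ → Plane} {γ η : ℝ → Plane}
    (hk : ∀ k, (γk k, ηk k) ∈ admissible A₀) (hγ : MemH2imm γ) (hη : MemH1per η)
    (h1 : Tendsto (fun k => ∫ x in (0 : ℝ)..(2 * Real.pi),
      (‖γk k x - γ x‖ ^ 2 + ‖deriv (γk k) x - deriv γ x‖ ^ 2)) atTop (𝓝 0))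
    (h2 : Tendsto (fun k => ∫ x in (0 : ℝ)..(2 * Real.pi), ‖ηk k x - η x‖ ^ 2) atTop (𝓝 0)) :
    (γ, η) ∈ admissible A₀ := by
  refine ⟨hγ, hη, ?_, norm_eq_one_of_tendsto (fun k => (hk k).2.1) (fun k => (hk k).2.2.2) hη h2⟩
  have := tendsto_signedArea (fun k => (hk k).1) hγ h1
  refine tendsto_nhds_unique this ?_
  simp only [fun k => (hk k).2.2.1]
  exact tendsto_const_nhds

/-! ### Lower semicontinuity of the energy -/

/-- Integrate `(f - g)² ≥ 0`. The lower bound is affine in `f` and sharp at `f = g`, so it can be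
passed to a weak limit. -/
theorem two_mul_integral_mul_sub_le {f g : ℝ → ℝ} (hf : MemLp f 2 periodMeasure)
    (hg : MemLp g 2 periodMeasure) :
    2 * ∫ x, f x * g x ∂periodMeasure - ∫ x, g x ^ 2 ∂periodMeasure ≤
      ∫ x, f x ^ 2 ∂periodMeasure := by
  have hfg : Integrable (fun x => f x * g x) periodMeasure := hf.integrable_mul hg
  rw [← integral_const_mul, ← integral_sub (hfg.const_mul 2) hg.integrable_sq]
  refine integral_mono ((hfg.const_mul 2).sub hg.integrable_sq) hf.integrable_sq fun x => ?_
  nlinarith [sq_nonneg (f x - g x)]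

theorem two_mul_integral_inner_sub_le {f g : ℝ → Plane} (hf : MemLp f 2 periodMeasure)
    (hg : MemLp g 2 periodMeasure) :
    2 * ∫ x, ⟪f x, g x⟫ ∂periodMeasure - ∫ x, ‖g x‖ ^ 2 ∂periodMeasure ≤
      ∫ x, ‖f x‖ ^ 2 ∂periodMeasure := by
  have hfg := MemLp.integrable_inner hf hg
  have hg2 := MemLp.integrable_norm_sq hg
  rw [← integral_const_mul, ← integral_sub (hfg.const_mul 2) hg2]
  refine integral_mono ((hfg.const_mul 2).sub hg2) (MemLp.integrable_norm_sq hf) fun x => ?_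
  have := norm_sub_sq_real (f x) (g x)
  nlinarith [sq_nonneg ‖f x - g x‖]

/-- The density is linear in the weakly convergent `u` and `v`; the factors `l⁻¹`, `g` and `W` are
moved to the test side, where they converge pointwise. The bounds `c ≤ l` and `‖g‖ ≤ B` supply the
dominating function. -/
theorem tendsto_integral_bend_mul {δ c B C L : ℝ} {l : ℕ → ℝ} {u g v : ℕ → ℝ → Plane}
    {u' g' v' : ℝ → Plane} {W : ℝ → ℝ} (hc : 0 < c) (hcl : ∀ k, c ≤ l k)
    (hlL : Tendsto l atTop (𝓝 L)) (hgc : ∀ k, Continuous (g k)) (hgc' : Continuous g')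
    (hgB : ∀ k x, ‖g k x‖ ≤ B) (hgB' : ∀ x, ‖g' x‖ ≤ B)
    (hg : ∀ x, Tendsto (fun k => g k x) atTop (𝓝 (g' x)))
    (hu : ∀ k, MemLp (u k) 2 periodMeasure) (hv : ∀ k, MemLp (v k) 2 periodMeasure)
    (hu' : MemLp u' 2 periodMeasure) (hv' : MemLp v' 2 periodMeasure)
    (huC : ∀ k, ∫ x, ‖u k x‖ ^ 2 ∂periodMeasure ≤ C)
    (hvC : ∀ k, ∫ x, ‖v k x‖ ^ 2 ∂periodMeasure ≤ C)
    (huw : WeakLim u u') (hvw : WeakLim v v') (hW : MemLp W 2 periodMeasure) :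
    Tendsto (fun k => ∫ x, bend δ (l k) (u k) (g k) (v k) x * W x ∂periodMeasure) atTop
      (𝓝 (∫ x, bend δ L u' g' v' x * W x ∂periodMeasure)) := by
  have hL : 0 < L := hc.trans_le (ge_of_tendsto hlL (Eventually.of_forall hcl))
  have hcL : c ≤ L := ge_of_tendsto hlL (Eventually.of_forall hcl)
  have hB : 0 ≤ B := (norm_nonneg _).trans (hgB' 0)
  have hinv : Tendsto (fun k => (l k)⁻¹) atTop (𝓝 L⁻¹) := hlL.inv₀ hL.ne'
  have hle : ∀ {a : ℝ}, c ≤ a → ∀ (n : ℕ), |a⁻¹ ^ n| ≤ c⁻¹ ^ n := fun {a} ha n => by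
    have ha0 : 0 < a := hc.trans_le ha
    rw [abs_of_pos (by positivity)]
    gcongr
  have hsplit : ∀ {a : ℝ}, c ≤ a → ∀ {p q r : ℝ → Plane}, MemLp p 2 periodMeasure →
      MemLp r 2 periodMeasure → Continuous q → (∀ x, ‖q x‖ ≤ B) →
      ∫ x, bend δ a p q r x * W x ∂periodMeasure =
        ∫ x, ⟪p x, (a⁻¹ ^ 3 * W x) • rot (q x)⟫ ∂periodMeasure +
        ∫ x, ⟪r x, (δ * a⁻¹ ^ 2 * W x) • q x⟫ ∂periodMeasure := by
    intro a ha p q r hp hr hq hqB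
    rw [← integral_add]
    · refine integral_congr_ae (Eventually.of_forall fun x => ?_)
      simp only [bend, real_inner_smul_right]
      ring
    · refine MemLp.integrable_inner hp (hW.of_le_mul (c := |a⁻¹ ^ 3| * B)
        ((hW.1.const_mul _).smul (continuous_rot.comp hq).aestronglyMeasurable)
        (Eventually.of_forall fun x => ?_))
      rw [norm_smul, norm_rot, norm_mul, Real.norm_eq_abs (a⁻¹ ^ 3), mul_right_comm]
      gcongr
      exact hqB x
    · refine MemLp.integrable_inner hr (hW.of_le_mul (c := |δ * a⁻¹ ^ 2| * B)
        ((hW.1.const_mul _).smul hq.aestronglyMeasurable)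
        (Eventually.of_forall fun x => ?_))
      rw [norm_smul, norm_mul, Real.norm_eq_abs (δ * a⁻¹ ^ 2), mul_right_comm]
      gcongr
      exact hqB x
  rw [hsplit hcL hu' hv' hgc' hgB']
  simp only [fun k => hsplit (hcl k) (hu k) (hv k) (hgc k) (hgB k)]
  refine Tendsto.add ?_ ?_
  · refine huw.tendsto_inner (F := fun x => c⁻¹ ^ 3 * B * ‖W x‖) hu huC (hW.norm.const_mul _)
      (fun k => (hW.1.const_mul _).smul (continuous_rot.comp (hgc k)).aestronglyMeasurable)
      ((hW.1.const_mul _).smul (continuous_rot.comp hgc').aestronglyMeasurable)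
      (fun k => Eventually.of_forall fun x => ?_) (Eventually.of_forall fun x => ?_)
    · rw [norm_smul, norm_rot, norm_mul, Real.norm_eq_abs ((l k)⁻¹ ^ 3), mul_right_comm]
      gcongr
      · exact hle (hcl k) 3
      · exact hgB k x
    · exact ((hinv.pow 3).mul_const _).smul ((continuous_rot.tendsto _).comp (hg x))
  · refine hvw.tendsto_inner (F := fun x => |δ| * c⁻¹ ^ 2 * B * ‖W x‖) hv hvC
      (hW.norm.const_mul _)
      (fun k => (hW.1.const_mul _).smul (hgc k).aestronglyMeasurable)
      ((hW.1.const_mul _).smul hgc'.aestronglyMeasurable)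
      (fun k => Eventually.of_forall fun x => ?_) (Eventually.of_forall fun x => ?_)
    · rw [norm_smul, norm_mul, norm_mul, Real.norm_eq_abs ((l k)⁻¹ ^ 2), Real.norm_eq_abs δ,
        mul_right_comm]
      gcongr
      · exact hle (hcl k) 2
      · exact hgB k x
    · exact (((hinv.pow 2).const_mul δ).mul_const _).smul (hg x)

/-- Lower semicontinuity of the energy along curves of constant speed. -/
theorem energyLM_le_of_tendsto {δ lam m c B C L : ℝ} (hlam : 0 < lam) {l : ℕ → ℝ}
    {γk ηk : ℕ → ℝ → Plane} {γ η : ℝ → Plane} (hγk : ∀ k, MemH2imm (γk k))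
    (hηk : ∀ k, MemH1per (ηk k)) (hγ : MemH2imm γ) (hη : MemH1per η)
    (hl : ∀ k x, ‖deriv (γk k) x‖ = l k) (hL : ∀ x, ‖deriv γ x‖ = L)
    (hc : 0 < c) (hcl : ∀ k, c ≤ l k) (hlB : ∀ k, l k ≤ B) (hlL : Tendsto l atTop (𝓝 L))
    (hg : ∀ x, Tendsto (fun k => deriv (γk k) x) atTop (𝓝 (deriv γ x)))
    (huC : ∀ k, ∫ x, ‖deriv (deriv (γk k)) x‖ ^ 2 ∂periodMeasure ≤ C)
    (hvC : ∀ k, ∫ x, ‖deriv (ηk k) x‖ ^ 2 ∂periodMeasure ≤ C)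
    (huw : WeakLim (fun k => deriv (deriv (γk k))) (deriv (deriv γ)))
    (hvw : WeakLim (fun k => deriv (ηk k)) (deriv η))
    (hE : Tendsto (fun k => energyLM δ lam (γk k, ηk k)) atTop (𝓝 m)) :
    energyLM δ lam (γ, η) ≤ m := by
  have hLc : c ≤ L := ge_of_tendsto hlL (Eventually.of_forall hcl)
  have hLB : L ≤ B := le_of_tendsto hlL (Eventually.of_forall hlB)
  have hL0 : 0 < L := hc.trans_le hLc
  have hu' : MemLp (deriv (deriv γ)) 2 periodMeasure := hγ.memH1per_deriv.memLp
  set W := bend δ L (deriv (deriv γ)) (deriv γ) (deriv η) with hWdef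
  have hW : MemLp W 2 periodMeasure :=
    memLp_bend δ L hu' hγ.continuous_deriv hη.memLp fun x => (hL x).le
  have hT1 := tendsto_integral_bend_mul (δ := δ) hc hcl hlL
    (fun k => (hγk k).continuous_deriv) hγ.continuous_deriv
    (fun k x => (hl k x).trans_le (hlB k)) (fun x => (hL x).trans_le hLB) hg
    (fun k => (hγk k).memH1per_deriv.memLp) (fun k => (hηk k).memLp) hu' hη.memLp huC hvC huw hvw hW
  have hT2 := hvw (deriv η) hη.memLp
  -- The affine lower bounds, taken at the limit densities, converge; by sharpness their limit is
  -- exactly the energy of `(γ, η)`.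
  have hlow := (((hlL.div_const 2).mul ((hT1.const_mul 2).sub_const
      (∫ x, W x ^ 2 ∂periodMeasure))).add
    (((hlL.const_mul 2).inv₀ (by positivity) |>.const_mul lam).mul ((hT2.const_mul 2).sub_const
      (∫ x, ‖deriv η x‖ ^ 2 ∂periodMeasure)))).add (hlL.const_mul (2 * Real.pi))
  have hval : energyLM δ lam (γ, η) = L / 2 * (2 * ∫ x, W x * W x ∂periodMeasure -
      ∫ x, W x ^ 2 ∂periodMeasure) + lam * (2 * L)⁻¹ *
      (2 * ∫ x, ⟪deriv η x, deriv η x⟫ ∂periodMeasure - ∫ x, ‖deriv η x‖ ^ 2 ∂periodMeasure)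
      + 2 * Real.pi * L := by
    rw [energyLM_constSpeed δ lam η hL0 hL]
    simp only [← sq, real_inner_self_eq_norm_sq, ← hWdef]
    ring
  rw [hval]
  refine le_of_tendsto_of_tendsto hlow hE (Eventually.of_forall fun k => ?_)
  have hlk : 0 < l k := hc.trans_le (hcl k)
  have hWk : MemLp (bend δ (l k) (deriv (deriv (γk k))) (deriv (γk k)) (deriv (ηk k))) 2
      periodMeasure := memLp_bend δ (l k) (hγk k).memH1per_deriv.memLp (hγk k).continuous_deriv
        (hηk k).memLp fun x => (hl k x).le
  beta_reduce
  rw [energyLM_constSpeed δ lam (ηk k) hlk (hl k), div_eq_mul_inv lam]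
  gcongr
  · exact two_mul_integral_mul_sub_le hWk hW
  · exact two_mul_integral_inner_sub_le (hηk k).memLp hη.memLp

/-! ### Existence of a minimizer -/

theorem energyLM_nonneg {δ lam : ℝ} (hlam : 0 < lam) (p : (ℝ → Plane) × (ℝ → Plane)) :
    0 ≤ energyLM δ lam p := by
  have h : ∀ f : ℝ → ℝ, (∀ x, 0 ≤ f x) → 0 ≤ curveIntegral p.1 f := fun f hf =>
    intervalIntegral.integral_nonneg two_pi_nonneg fun x _ => mul_nonneg (hf x) (norm_nonneg _)
  have h1 := h _ fun x => sq_nonneg (curvature p.1 x + δ * curveDiv p.1 p.2 x)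
  have h2 := h (fun x => frobeniusSq (curveGrad p.1 p.2 x)) fun x =>
    Finset.sum_nonneg fun i _ => Finset.sum_nonneg fun j _ => sq_nonneg _
  have h3 : 0 ≤ length p.1 :=
    intervalIntegral.integral_nonneg two_pi_nonneg fun x _ => norm_nonneg _
  unfold energyLM
  positivity

theorem admissible_nonempty (A₀ : ℝ) : (admissible A₀).Nonempty := by
  by_cases h : A₀ = 0
  · subst h; exact ⟨_, figureEight_mem⟩
  · exact ⟨_, circleOfArea_mem h⟩

/-- Primitives of pointwise convergent, uniformly bounded derivatives. -/
theorem exists_curve_limit {γk : ℕ → ℝ → Plane} {g : ℝ → Plane} {B c : ℝ}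
    (hγk : ∀ k, MemH2imm (γk k)) (h0 : ∀ k, γk k 0 = 0) (hB : ∀ k x, ‖deriv (γk k) x‖ ≤ B)
    (hg : MemH1per g) (hlim : ∀ x, Tendsto (fun k => deriv (γk k) x) atTop (𝓝 (g x)))
    (hc : 0 < c) (hgc : ∀ x, c ≤ ‖g x‖) :
    ∃ γ, MemH2imm γ ∧ deriv γ = g ∧ Tendsto (fun k => ∫ x in (0 : ℝ)..(2 * Real.pi),
      (‖γk k x - γ x‖ ^ 2 + ‖deriv (γk k) x - deriv γ x‖ ^ 2)) atTop (𝓝 0) := by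
  have hB0 : 0 ≤ B := (norm_nonneg _).trans (hB 0 0)
  have hgB : ∀ x, ‖g x‖ ≤ B := fun x => le_of_tendsto (hlim x).norm
    (Eventually.of_forall fun k => hB k x)
  set γ : ℝ → Plane := fun x => ∫ t in (0 : ℝ)..x, g t with hγ
  have hd : ∀ x, HasDerivAt γ (g x) x := fun x =>
    (hg.continuous.integral_hasStrictDerivAt 0 x).hasDerivAt
  have hderiv : deriv γ = g := funext fun x => (hd x).deriv
  have heq : ∀ k x, γk k x = ∫ t in (0 : ℝ)..x, deriv (γk k) t := fun k x => by
    rw [intervalIntegral.integral_deriv_eq_sub (fun x _ => (hγk k).differentiable x)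
      ((hγk k).continuous_deriv.intervalIntegrable _ _), h0, sub_zero]
  have hpt : ∀ x, Tendsto (fun k => γk k x) atTop (𝓝 (γ x)) := fun x => by
    simp only [heq]
    exact intervalIntegral.tendsto_integral_filter_of_dominated_convergence (fun _ => B)
      (Eventually.of_forall fun k => (hγk k).continuous_deriv.aestronglyMeasurable)
      (Eventually.of_forall fun k => Eventually.of_forall fun t _ => hB k t)
      intervalIntegrable_const (Eventually.of_forall fun t _ => hlim t)
  have hγB : ∀ (k : ℕ), ∀ x ∈ Set.Ioc 0 (2 * Real.pi), ‖γk k x‖ ≤ B * (2 * Real.pi) := by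
    intro k x hx
    rw [heq]
    refine (intervalIntegral.norm_integral_le_of_norm_le_const fun t _ => hB k t).trans ?_
    rw [sub_zero, abs_of_pos hx.1]
    exact mul_le_mul_of_nonneg_left hx.2 hB0
  -- The limit curve closes up because it is a pointwise limit of periodic curves.
  have hp : Function.Periodic γ (2 * Real.pi) := fun x => tendsto_nhds_unique (hpt _)
    ((hpt x).congr fun k => ((hγk k).mem_H2per.periodic x).symm)
  refine ⟨γ, ⟨⟨hp, fun x => (hd x).differentiableAt, hderiv ▸ hg⟩, fun x => ?_⟩, hderiv, ?_⟩
  · rw [hderiv, ← norm_pos_iff]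
    exact hc.trans_le (hgc x)
  · simp only [hderiv]
    have hγc : Continuous γ := continuous_iff_continuousAt.2 fun x => (hd x).continuousAt
    have := intervalIntegral.tendsto_integral_filter_of_dominated_convergence
      (μ := volume) (a := 0) (b := 2 * Real.pi) (l := atTop)
      (F := fun k x => ‖γk k x - γ x‖ ^ 2 + ‖deriv (γk k) x - g x‖ ^ 2) (f := fun _ => (0 : ℝ))
      (fun _ => (2 * (B * (2 * Real.pi))) ^ 2 + (2 * B) ^ 2)
      (Eventually.of_forall fun k => ((((hγk k).differentiable.continuous.sub hγc).norm.pow 2).add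
        (((hγk k).continuous_deriv.sub hg.continuous).norm.pow 2)).aestronglyMeasurable)
      (Eventually.of_forall fun k => Eventually.of_forall fun x hx => ?_)
      intervalIntegrable_const (Eventually.of_forall fun x _ => ?_)
    · simpa using this
    · rw [Set.uIoc_of_le two_pi_nonneg] at hx
      have h1 : ‖γ x‖ ≤ B * (2 * Real.pi) :=
        le_of_tendsto (hpt x).norm (Eventually.of_forall fun k => hγB k x hx)
      have h2 := (norm_sub_le _ _).trans (add_le_add (hγB k x hx) h1)
      have h3 := (norm_sub_le _ _).trans (add_le_add (hB k x) (hgB x))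
      rw [← two_mul] at h2 h3
      rw [Real.norm_eq_abs, abs_of_nonneg (by positivity)]
      gcongr
    · have h1 := ((hpt x).sub_const (γ x)).norm.pow 2
      have h2 := ((hlim x).sub_const (g x)).norm.pow 2
      simpa using h1.add h2

theorem tendsto_integral_norm_sub_sq {ηk : ℕ → ℝ → Plane} {η : ℝ → Plane}
    (hk : ∀ k, MemH1per (ηk k)) (h1 : ∀ k x, ‖ηk k x‖ = 1) (hη : MemH1per η)
    (hlim : ∀ x, Tendsto (fun k => ηk k x) atTop (𝓝 (η x))) :
    Tendsto (fun k => ∫ x in (0 : ℝ)..(2 * Real.pi), ‖ηk k x - η x‖ ^ 2) atTop (𝓝 0) := by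
  have := intervalIntegral.tendsto_integral_filter_of_dominated_convergence
    (μ := volume) (a := 0) (b := 2 * Real.pi) (l := atTop)
    (F := fun k x => ‖ηk k x - η x‖ ^ 2) (f := fun _ => (0 : ℝ)) (fun _ => (1 + 1) ^ 2)
    (Eventually.of_forall fun k =>
      (((hk k).continuous.sub hη.continuous).norm.pow 2).aestronglyMeasurable)
    (Eventually.of_forall fun k => Eventually.of_forall fun x _ => ?_)
    intervalIntegrable_const (Eventually.of_forall fun x _ => ?_)
  · simpa using this
  · have h2 : ‖η x‖ ≤ 1 :=
      le_of_tendsto (hlim x).norm (Eventually.of_forall fun k => (h1 k x).le)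
    rw [Real.norm_eq_abs, abs_of_nonneg (by positivity)]
    gcongr
    exact (norm_sub_le _ _).trans (add_le_add (h1 k x).le h2)
  · simpa using ((hlim x).sub_const (η x)).norm.pow 2

theorem exists_isMinOn (δ : ℝ) {lam : ℝ} (A₀ : ℝ) (hlam : 0 < lam) :
    ∃ γ η : ℝ → Plane, (γ, η) ∈ admissible A₀ ∧
      IsMinOn (energyLM δ lam) (admissible A₀) (γ, η) ∧
      ∀ x, ‖deriv γ x‖ = length γ / (2 * Real.pi) := by
  have hbdd : BddBelow (energyLM δ lam '' admissible A₀) :=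
    ⟨0, by rintro _ ⟨p, -, rfl⟩; exact energyLM_nonneg hlam p⟩
  obtain ⟨e, -, he, hmem⟩ := exists_seq_tendsto_sInf ((admissible_nonempty A₀).image _) hbdd
  set m := sInf (energyLM δ lam '' admissible A₀) with hm
  choose p hp hpe using hmem
  choose γk ηk hadm hEk hspeed h0 using fun k => exists_constSpeed δ lam (hp k)
  have hE : Tendsto (fun k => energyLM δ lam (γk k, ηk k)) atTop (𝓝 m) :=
    he.congr fun k => by rw [hEk, hpe]
  obtain ⟨M, hM⟩ := hE.bddAbove_range
  have hM' : ∀ k, energyLM δ lam (γk k, ηk k) ≤ M := fun k => hM ⟨k, rfl⟩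
  have hγk : ∀ k, MemH2imm (γk k) := fun k => (hadm k).1
  have hηk : ∀ k, MemH1per (ηk k) := fun k => (hadm k).2.1
  set l : ℕ → ℝ := fun k => length (γk k) / (2 * Real.pi) with hldef
  have hl0 : ∀ k, 0 < l k := fun k => div_pos (hγk k).length_pos Real.two_pi_pos
  have hco := fun k => coercive hlam (hadm k) (hspeed k) (hM' k)
  set B := M / (2 * Real.pi) with hBdef
  set K := 4 * M * (1 + δ ^ 2 / lam) with hKdef
  have hlB : ∀ k, l k ≤ B := fun k => by
    rw [hBdef, le_div_iff₀ Real.two_pi_pos, mul_comm]; exact (hco k).1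
  have hB0 : 0 < B := (hl0 0).trans_le (hlB 0)
  have hM0 : 0 < M := (mul_pos Real.two_pi_pos (hl0 0)).trans_le (hco 0).1
  have hK0 : 0 < K := by positivity
  -- This uniform lower bound keeps the limit curve regular.
  have hcl : ∀ k, (2 * Real.pi * K)⁻¹ ≤ l k := fun k => by
    rw [inv_le_iff_one_le_mul₀ (by positivity), mul_comm]
    exact (hco k).2.2.2
  set C := max (2 * M * B / lam) (K * B ^ 3)
  have hvC : ∀ k, ∫ x, ‖deriv (ηk k) x‖ ^ 2 ∂periodMeasure ≤ C := fun k =>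
    (hco k).2.1.trans (le_max_of_le_left (by have := hlB k; gcongr))
  have huC : ∀ k, ∫ x, ‖deriv (deriv (γk k)) x‖ ^ 2 ∂periodMeasure ≤ C := fun k =>
    (hco k).2.2.1.trans (le_max_of_le_right (by have := hlB k; have := (hl0 k).le; gcongr))
  obtain ⟨g, hg, s, hs, hglim, huw⟩ := exists_H1_limit (M := B)
    (fun k => (hγk k).memH1per_deriv) (fun k => (hspeed k 0).trans_le (hlB k)) huC
  -- Extracted along the first subsequence, so that both limits exist along `s ∘ r`.
  obtain ⟨η, hη, r, hr, hηlim, hvw⟩ := exists_H1_limit (M := 1) (fun k => hηk (s k))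
    (fun k => ((hadm (s k)).2.2.2 0).le) (fun k => hvC (s k))
  have hglim' : ∀ x, Tendsto (fun k => deriv (γk (s (r k))) x) atTop (𝓝 (g x)) := fun x =>
    (hglim x).comp hr.tendsto_atTop
  have hlL : ∀ x, Tendsto (fun k => l (s (r k))) atTop (𝓝 ‖g x‖) := fun x =>
    (hglim' x).norm.congr fun k => hspeed _ x
  -- The speeds `l` do not depend on `x`, hence neither does their limit.
  have hgL : ∀ x, ‖g x‖ = ‖g 0‖ := fun x => tendsto_nhds_unique (hlL x) (hlL 0)
  have hc0 : 0 < (2 * Real.pi * K)⁻¹ := by positivity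
  obtain ⟨γ, hγ, hγg, hconv⟩ := exists_curve_limit (fun k => hγk (s (r k))) (fun k => h0 _)
    (fun k x => (hspeed _ x).trans_le (hlB _)) hg hglim' hc0
    fun x => ge_of_tendsto (hlL x) (Eventually.of_forall fun k => hcl _)
  subst hγg
  refine ⟨γ, η, mem_admissible_of_tendsto (fun k => hadm (s (r k))) hγ hη hconv
    (tendsto_integral_norm_sub_sq (fun k => hηk _) (fun k => (hadm _).2.2.2) hη hηlim), ?_, ?_⟩
  · have hle : energyLM δ lam (γ, η) ≤ m := energyLM_le_of_tendsto hlam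
      (fun k => hγk (s (r k))) (fun k => hηk _) hγ hη (fun k x => hspeed _ x) hgL hc0
      (fun k => hcl _) (fun k => hlB _) (hlL 0) hglim' (fun k => huC _) (fun k => hvC _)
      (huw.comp hr) hvw (hE.comp (hs.comp hr).tendsto_atTop)
    exact fun q hq => hle.trans (csInf_le hbdd ⟨q, hq, rfl⟩)
  · intro x
    rw [length_constSpeed hgL, hgL]
    field_simp

end Surfactant

end

theorem mainTheorem2 (δ lam A₀ : ℝ) (hlam : 0 < lam) :
    -- the admissible class is nonempty: a circle, or a figure eight, with its unit normal field
    (A₀ ≠ 0 → (Surfactant.circleOfArea A₀, Surfactant.normal (Surfactant.circleOfArea A₀)) ∈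
      Surfactant.admissible A₀) ∧
    (A₀ = 0 → (Surfactant.figureEight, Surfactant.normal Surfactant.figureEight) ∈
      Surfactant.admissible A₀) ∧
    -- the constraints pass to the limit under strong convergence in `H¹ × L²`
    (∀ (γk ηk : ℕ → ℝ → Surfactant.Plane) (γ η : ℝ → Surfactant.Plane),
      (∀ k, (γk k, ηk k) ∈ Surfactant.admissible A₀) →
      Surfactant.MemH2imm γ → Surfactant.MemH1per η →
      Tendsto (fun k => ∫ x in (0 : ℝ)..(2 * Real.pi),
        (‖γk k x - γ x‖ ^ 2 + ‖deriv (γk k) x - deriv γ x‖ ^ 2)) atTop (𝓝 0) →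
      Tendsto (fun k => ∫ x in (0 : ℝ)..(2 * Real.pi), ‖ηk k x - η x‖ ^ 2) atTop (𝓝 0) →
      (γ, η) ∈ Surfactant.admissible A₀) ∧
    -- there is a minimizer, and it can be chosen with constant speed and vanishing mean value
    (∃ γ η : ℝ → Surfactant.Plane, (γ, η) ∈ Surfactant.admissible A₀ ∧
      IsMinOn (Surfactant.energyLM δ lam) (Surfactant.admissible A₀) (γ, η) ∧
      (∀ x, ‖deriv γ x‖ = Surfactant.length γ / (2 * Real.pi)) ∧
      (∫ x in (0 : ℝ)..(2 * Real.pi), γ x) = 0) := by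
  refine ⟨Surfactant.circleOfArea_mem, fun h => h ▸ Surfactant.figureEight_mem,
    fun γk ηk γ η hk hγ hη h1 h2 => Surfactant.mem_admissible_of_tendsto hk hγ hη h1 h2, ?_⟩
  obtain ⟨γ, η, hadm, hmin, hspeed⟩ := Surfactant.exists_isMinOn δ A₀ hlam
  -- Minus the mean of `γ`: translating by it preserves energy and constraints and replaces the base
  -- point normalization.
  set c := -((2 * Real.pi)⁻¹ • ∫ x in (0 : ℝ)..(2 * Real.pi), γ x) with hc
  refine ⟨fun x => γ x + c, η, Surfactant.admissible_add_const hadm c, ?_, ?_, ?_⟩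
  · intro q hq
    change Surfactant.energyLM δ lam _ ≤ _
    rw [Surfactant.energyLM_add_const]
    exact hmin hq
  · simpa only [Surfactant.length, deriv_add_const'] using hspeed
  · rw [intervalIntegral.integral_add
      (hadm.1.differentiable.continuous.intervalIntegrable _ _) intervalIntegrable_const,
      intervalIntegral.integral_const, sub_zero, hc, smul_neg, smul_smul,
      mul_inv_cancel₀ Real.two_pi_pos.ne', one_smul, add_neg_cancel]
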